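/- Let $p$ be a prime and $K$ a field extension of $\mathbf{Q}_p$ with an ultrametric absolute value extending that of $\mathbf{Q}_p$; let $R=\{x\in K:|x|\le 1\}$. Let $D\ge 1$, put $d=\lfloor\log_p D\rfloor$, and assume that $K$ contains a root of unity $\zeta$ of order exactly $p^{d+1}$. For $0\le j\le d$ put $\zeta_j=\zeta^{p^{d-j}}$ (of order $p^{j+1}$) and $\pi_j=\zeta_j-1$; for $1\le i\le D$ put $d_i=\lfloor\log_p(D/i)\rfloor$. For a ring $A$, a universal (big) Witt vector $x=(x_1,x_2,\dots)\in\mathbb{W}(A)$ corresponds to the series $\prod_{n\ge1}(1-x_nT^n)\in 1+TA[[T]]$ and has ghost components $\sum_{m\mid n}m\,x_m^{n/m}$ ($n\ge 1$); the ring operations of $\mathbb{W}(A)$ are the ones, functorial in $A$, that are componentwise on ghost components. $\mathbb{W}_D(A)$ denotes the Witt vectors truncated to the coordinates $x_1,\dots,x_D$. Let $\upsilon_D$ be the universal Witt vector corresponding to the series $$\exp\Bigl(\pi_{d_1}\frac{T}{1}+\pi_{d_2}\frac{T^2}{2}+\dots+\pi_{d_D}\frac{T^D}{D}\Bigr).$$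 Then $\upsilon_D\in\mathbb{W}(R)$. Let $v=(u_1,\dots,u_D)\in\mathbb{W}_D(R)$ be such that $\sup_{1\le i\le D}|u_i|=1$. The product $x\times\upsilon_D$ is the same for all $x\in\mathbb{W}(R)$ with truncation $v$; call it $v\times\upsilon_D$. The coefficients of the series $1+\sum_{i\ge1}a_iT^i$ corresponding to $v\times\upsilon_D$ satisfy $$|\pi_0|\le\limsup_{i}|a_i|<1 .$$ Consequently this series has radius of convergence exactly $1$. -/

import Mathlib

open Filter
open scoped ENNReal PowerSeries

/-- Big (universal) Witt vectors over `A`, given by their coordinates `(x₁, x₂, …)`. -/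
@[ext]
structure BigWitt (A : Type*) where
  /-- The coordinates of the Witt vector. -/
  coord : ℕ+ → A

/-- Truncated big Witt vectors over `A` of length `D`, given by their coordinates: the entry of
index `i : Fin D` is the coordinate `u_{i+1}`. -/
@[ext]
structure TruncBigWitt (D : ℕ) (A : Type*) where
  /-- The coordinates of the truncated Witt vector. -/
  coord : Fin D → A

/-- A map on sequences which is triangular, with bijective diagonal entries, is bijective. -/
theorem bijective_of_triangular {ι A B : Type*} [LinearOrder ι] [WellFoundedLT ι] [Nonempty A]
    (Φ : (ι → A) → ι → B) (φ : ι → (ι → A) → A → B)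
    (hΦ : ∀ x n, Φ x n = φ n x (x n))
    (hφ : ∀ n x y, (∀ k < n, x k = y k) → φ n x = φ n y)
    (hb : ∀ n x, Function.Bijective (φ n x)) : Function.Bijective Φ := by
  constructor
  · intro x y hxy
    funext n
    induction n using WellFoundedLT.induction with
    | ind n ih =>
      have h := congrFun hxy n
      rw [hΦ, hΦ, hφ n x y ih] at h
      exact (hb n y).1 h
  · intro b
    inhabit A
    let F : (n : ι) → ((k : ι) → k < n → A) → A := fun n ih =>
      Function.surjInv (hb n fun k => if h : k < n then ih k h else default).2 (b n)
    let x : ι → A := fun n => (wellFounded_lt (α := ι)).fix F n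
    refine ⟨x, ?_⟩
    funext n
    have hx : x n = F n fun k _ => x k := WellFounded.fix_eq _ F n
    rw [hΦ, hφ n x (fun k => if _ : k < n then x k else default)
      (fun k hk => by simp [hk]), hx]
    exact Function.surjInv_eq _ _

namespace BigWitt

/-- Functoriality of big Witt vectors, coordinate by coordinate. -/
def map {A B : Type*} [CommRing A] [CommRing B] (f : A →+* B) (x : BigWitt A) : BigWitt B :=
  ⟨fun n => f (x.coord n)⟩

/-- Truncation to the first `D` coordinates. -/
def trunc {A : Type*} (D : ℕ) (x : BigWitt A) : TruncBigWitt D A :=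
  ⟨fun i => x.coord (Nat.succPNat i)⟩

/-- The ghost components `∑_{d ∣ n} d x_d ^ (n / d)`. -/
def ghost {A : Type*} [CommRing A] (x : BigWitt A) (n : ℕ+) : A :=
  ∑ d ∈ (Finset.Icc 1 n).filter (fun d : ℕ+ => (d : ℕ) ∣ (n : ℕ)),
    ((d : ℕ) : A) * x.coord d ^ ((n : ℕ) / (d : ℕ))

/-- The series `∏_{n ≥ 1} (1 - x_n T^n)` attached to a big Witt vector; its coefficient of degree
`N` is that of the finite product over `n ≤ N`. -/
noncomputable def toSeries {A : Type*} [CommRing A] (x : BigWitt A) : A⟦X⟧ :=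
  PowerSeries.mk fun N => PowerSeries.coeff N
    (∏ n ∈ Finset.range N,
      (1 - PowerSeries.C (x.coord (Nat.succPNat n)) * PowerSeries.X ^ (n + 1)))

theorem ghost_bijective (K : Type*) [Field K] [CharZero K] :
    Function.Bijective (ghost : BigWitt K → ℕ+ → K) := by
  have key : Function.Bijective (fun (x : ℕ+ → K) => ghost ⟨x⟩) := by
    have : Nonempty K := ⟨0⟩
    refine bijective_of_triangular _ (fun n x a =>
      ∑ d ∈ ((Finset.Icc 1 n).filter (fun d : ℕ+ => (d : ℕ) ∣ (n : ℕ))).erase n,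
        ((d : ℕ) : K) * x d ^ ((n : ℕ) / (d : ℕ)) + ((n : ℕ) : K) * a) ?_ ?_ ?_
    · intro x n
      have hn : n ∈ (Finset.Icc 1 n).filter (fun d : ℕ+ => (d : ℕ) ∣ (n : ℕ)) := by simp
      simp only [ghost]
      rw [← Finset.sum_erase_add _ _ hn, Nat.div_self n.pos, pow_one]
    · intro n x y h
      funext a
      congr 1
      refine Finset.sum_congr rfl fun d hd => ?_
      simp only [Finset.mem_erase, Finset.mem_filter, Finset.mem_Icc] at hd
      rw [h d (lt_of_le_of_ne hd.2.1.2 hd.1)]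
    · intro n x
      have hn : ((n : ℕ) : K) ≠ 0 := Nat.cast_ne_zero.mpr n.ne_zero
      exact (AddGroup.addLeft_bijective _).comp (mulLeft_bijective₀ _ hn)
  have e : Function.Bijective (BigWitt.coord : BigWitt K → ℕ+ → K) :=
    ⟨fun _ _ h => BigWitt.ext h, fun f => ⟨⟨f⟩, rfl⟩⟩
  exact key.comp e

/-- Over a field of characteristic zero, a big Witt vector amounts to its ghost components. -/
noncomputable def ghostEquiv (K : Type*) [Field K] [CharZero K] : BigWitt K ≃ (ℕ+ → K) :=
  Equiv.ofBijective ghost (ghost_bijective K)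

/-- The ring of big Witt vectors over a field of characteristic zero: the unique ring structure
for which addition and multiplication are componentwise on ghost components. (For a subring `R`
of `K`, the ring of big Witt vectors over `R` is the subring of the vectors with coordinates in
`R`.) -/
noncomputable instance (K : Type*) [Field K] [CharZero K] : CommRing (BigWitt K) :=
  (ghostEquiv K).commRing

theorem ghost_add {K : Type*} [Field K] [CharZero K] (x y : BigWitt K) :
    ghost (x + y) = ghost x + ghost y :=
  (ghostEquiv K).apply_symm_apply _

theorem ghost_mul {K : Type*} [Field K] [CharZero K] (x y : BigWitt K) :
    ghost (x * y) = ghost x * ghost y :=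
  (ghostEquiv K).apply_symm_apply _

theorem constantCoeff_toSeries {A : Type*} [CommRing A] (x : BigWitt A) :
    PowerSeries.constantCoeff x.toSeries = 1 := by
  rw [← PowerSeries.coeff_zero_eq_constantCoeff_apply]
  simp [toSeries]

theorem existsUnique_toSeries {A : Type*} [CommRing A] (f : A⟦X⟧)
    (hf : PowerSeries.constantCoeff f = 1) : ∃! x : BigWitt A, x.toSeries = f := by
  have key : Function.Bijective (fun (x : ℕ+ → A) (n : ℕ+) =>
      PowerSeries.coeff (n : ℕ) (toSeries ⟨x⟩)) := by
    have : Nonempty A := ⟨0⟩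
    refine bijective_of_triangular _ (fun n x a =>
      PowerSeries.coeff (n : ℕ) (∏ k ∈ Finset.range n.natPred,
        (1 - PowerSeries.C (x (Nat.succPNat k)) * PowerSeries.X ^ (k + 1))) - a) ?_ ?_ ?_
    · intro x n
      obtain ⟨m, rfl⟩ : ∃ m : ℕ, n = Nat.succPNat m := ⟨n.natPred, by simp⟩
      simp only [toSeries, PowerSeries.coeff_mk, Nat.natPred_succPNat, Nat.succPNat_coe,
        Nat.succ_eq_add_one]
      have h1 : ∀ (g : A⟦X⟧) (a : A), PowerSeries.coeff (m + 1)
          (g * (PowerSeries.C a * PowerSeries.X ^ (m + 1))) =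
            PowerSeries.constantCoeff g * a := by
        intro g a
        rw [← mul_assoc, PowerSeries.coeff_mul_X_pow', if_pos le_rfl, Nat.sub_self,
          PowerSeries.coeff_zero_eq_constantCoeff_apply, map_mul, PowerSeries.constantCoeff_C]
      rw [Finset.prod_range_succ, mul_sub, mul_one, map_sub, h1, map_prod PowerSeries.constantCoeff]
      simp
    · intro n x y h
      funext a
      congr 2
      refine Finset.prod_congr rfl fun k hk => ?_
      rw [h]
      rw [Finset.mem_range] at hk
      rw [← PNat.coe_lt_coe, Nat.succPNat_coe, ← PNat.natPred_add_one n]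
      omega
    · intro n x
      exact ⟨fun a b h => sub_right_injective h, fun b => ⟨_, sub_sub_cancel _ b⟩⟩
  have ext_iff' : ∀ x : BigWitt A, x.toSeries = f ↔
      (fun n : ℕ+ => PowerSeries.coeff (n : ℕ) x.toSeries) =
        fun n : ℕ+ => PowerSeries.coeff (n : ℕ) f := by
    intro x
    refine ⟨fun h => by rw [h], fun h => ?_⟩
    ext n
    rcases Nat.eq_zero_or_pos n with rfl | hn
    · simp only [PowerSeries.coeff_zero_eq_constantCoeff_apply]
      rw [constantCoeff_toSeries, hf]
    · exact congrFun h ⟨n, hn⟩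
  obtain ⟨x, hx⟩ := key.2 fun n : ℕ+ => PowerSeries.coeff (n : ℕ) f
  refine ⟨⟨x⟩, (ext_iff' _).2 hx, fun y hy => ?_⟩
  exact BigWitt.ext (key.1 (((ext_iff' y).1 hy).trans hx.symm))

/-- The big Witt vector attached to a series with constant term `1` (inverse of `toSeries`). -/
noncomputable def ofSeries {A : Type*} [CommRing A] (f : A⟦X⟧)
    (hf : PowerSeries.constantCoeff f = 1) : BigWitt A :=
  (existsUnique_toSeries f hf).choose

theorem toSeries_ofSeries {A : Type*} [CommRing A] (f : A⟦X⟧)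
    (hf : PowerSeries.constantCoeff f = 1) : (ofSeries f hf).toSeries = f :=
  (existsUnique_toSeries f hf).choose_spec.1

end BigWitt

section PiExp

variable {K : Type*} [Field K]

/-- For `ζ` a root of unity of order `p ^ (d + 1)` with `d = ⌊log_p D⌋`, this is
`π_j = ζ_j - 1` for `j ≤ d`, where `ζ_j = ζ ^ (p ^ (d - j))` has order `p ^ (j + 1)`. -/
def piParam (p D : ℕ) (ζ : K) (j : ℕ) : K :=
  ζ ^ p ^ (Nat.log p D - j) - 1

/-- The polynomial `∑_{1 ≤ i ≤ D} π_{d_i} T^i / i`, where `d_i = ⌊log_p (D / i)⌋`. -/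
noncomputable def piPoly (p D : ℕ) (ζ : K) : K⟦X⟧ :=
  ∑ i ∈ Finset.Icc 1 D,
    PowerSeries.C (piParam p D ζ (Nat.log p (D / i)) / (i : K)) * PowerSeries.X ^ i

theorem constantCoeff_piPoly (p D : ℕ) (ζ : K) :
    PowerSeries.constantCoeff (piPoly p D ζ) = 0 := by
  rw [piPoly, map_sum]
  refine Finset.sum_eq_zero fun i hi => ?_
  have : i ≠ 0 := by
    have := (Finset.mem_Icc.1 hi).1
    omega
  simp [this]

/-- The series `exp (∑_{1 ≤ i ≤ D} π_{d_i} T^i / i)`. -/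
noncomputable def piExp [CharZero K] (p D : ℕ) (ζ : K) : K⟦X⟧ :=
  (PowerSeries.exp K).subst (piPoly p D ζ)

theorem constantCoeff_piExp [CharZero K] (p D : ℕ) (ζ : K) :
    PowerSeries.constantCoeff (piExp p D ζ) = 1 := by
  have h : MvPowerSeries.constantCoeff (piPoly p D ζ) = 0 := constantCoeff_piPoly p D ζ
  have hs : PowerSeries.HasSubst (piPoly p D ζ) :=
    PowerSeries.HasSubst.of_constantCoeff_zero h
  have key := PowerSeries.constantCoeff_subst hs (PowerSeries.exp K)
  rw [finsum_eq_single _ 0] at key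
  · refine key.trans ?_
    simp
  · intro n hn
    simp [h, hn]

/-- The big Witt vector `υ_D` attached to the series `exp (∑_{1 ≤ i ≤ D} π_{d_i} T^i / i)`. -/
noncomputable def upsilon [CharZero K] (p D : ℕ) (ζ : K) : BigWitt K :=
  BigWitt.ofSeries (piExp p D ζ) (constantCoeff_piExp p D ζ)

end PiExp

/-- The ring of integers (closed unit ball) of an ultrametric field. -/
noncomputable abbrev unitBall (K : Type*) [NormedField K] [IsUltrametricDist K] : Subring K :=
  (NormedField.valuation (K := K)).integer

/-! Up to sign, the ghost components of a Witt vector are the coefficients of `X F' / F`, where `F`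
is its series. In characteristic zero this logarithmic derivative determines `F`, so every identity
between exponentials and Witt products is checked on it. Since `υ_D` has ghost components `-π_{d_n}`
for `n ≤ D` and `0` beyond, `v × υ_D` is the finite product of the `U_n(u_n T^n)`, `n ≤ D`, with
`U_n = exp(∑_{k ≤ D/n} π_{d_{nk}} T^k / k)`.

Upper bound: grouping the exponents by their prime-to-`p` part writes `U_n` as a product of
quotients `A(ηT)/A(T)`, with `A` of Artin-Hasse type over `ℤ_[p]` (by Dwork's criterion) and `η` a
power of `ζ`. Hence `U_n` is integral and congruent to `1` modulo `ζ - 1`, where `|ζ - 1| < 1`.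

Lower bound: otherwise the product is a polynomial modulo `J = {|x| < |π_0|}`. Let `n₀` be the least
index with `|u_n| = 1`. The factors of smaller index have inverses polynomial modulo `J`, so they
can be removed. With `s = ⌊log_p (D/n₀)⌋`, the `p^s`-th power of what remains is `exp(π_0 h) = 1 +
π_0 z`, with `h` and `z` integral. Comparing its `p`-th power with `exp(π_0 p h)` gives `z - z^p ≡
h` modulo the maximal ideal. Modulo that ideal `h` is nonzero and supported in degrees `D/p < N ≤
D`, so the lowest and highest degrees show that `z` is not a polynomial
(`Polynomial.eq_zero_of_sub_pow_eq`, `PowerSeries.not_eventually_mem_of_isLogDeriv`). -/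

namespace PowerSeries

/-! ### Logarithmic derivatives of power series -/

section LogDeriv

variable {R : Type*} [CommRing R]

theorem coeff_X_mul_derivative (F : R⟦X⟧) (N : ℕ) :
    coeff N (X * d⁄dX R F) = N * coeff N F := by
  cases N with
  | zero => simp
  | succ n => rw [mul_comm X, coeff_succ_mul_X, coeff_derivative]; push_cast; ring

/-- `g` is the logarithmic derivative of `F` for the derivation `X d/dX`. -/
def IsLogDeriv (F g : R⟦X⟧) : Prop := X * d⁄dX R F = g * F

theorem exists_mul_eq_one {F : R⟦X⟧} (hF : constantCoeff F = 1) :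
    ∃ G : R⟦X⟧, F * G = 1 ∧ constantCoeff G = 1 := by
  have : IsUnit F := by rw [isUnit_iff_constantCoeff, hF]; exact isUnit_one
  obtain ⟨G, hG⟩ := this.exists_right_inv
  refine ⟨G, hG, ?_⟩
  simpa [hF] using congrArg (constantCoeff (R := R)) hG

namespace IsLogDeriv

theorem one : IsLogDeriv (1 : R⟦X⟧) 0 := by simp [IsLogDeriv]

theorem mul {F G g h : R⟦X⟧} (hF : IsLogDeriv F g) (hG : IsLogDeriv G h) :
    IsLogDeriv (F * G) (g + h) := by
  unfold IsLogDeriv at *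
  rw [Derivation.leibniz, smul_eq_mul, smul_eq_mul]
  linear_combination F * hG + G * hF

theorem pow {F g : R⟦X⟧} (hF : IsLogDeriv F g) (n : ℕ) : IsLogDeriv (F ^ n) (n * g) := by
  induction n with
  | zero => simpa using one
  | succ n ih => rw [pow_succ]; convert ih.mul hF using 1; push_cast; ring

theorem prod {ι : Type*} (s : Finset ι) {F g : ι → R⟦X⟧} (h : ∀ i ∈ s, IsLogDeriv (F i) (g i)) :
    IsLogDeriv (∏ i ∈ s, F i) (∑ i ∈ s, g i) := by
  classical
  induction s using Finset.induction_on with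
  | empty => simpa using one
  | insert a s ha ih =>
    rw [Finset.prod_insert ha, Finset.sum_insert ha]
    exact (h a (by simp)).mul (ih fun i hi => h i (by simp [hi]))

theorem of_mul_eq_one {F G g : R⟦X⟧} (hF : IsLogDeriv F g) (h : F * G = 1) :
    IsLogDeriv G (-g) := by
  have h1 : d⁄dX R (F * G) = 0 := by rw [h]; simp
  rw [Derivation.leibniz, smul_eq_mul, smul_eq_mul] at h1
  unfold IsLogDeriv at *
  linear_combination (-X * d⁄dX R G - g * G) * h + X * G * h1 - G * G * hF

theorem map {S : Type*} [CommRing S] (φ : R →+* S) {F g : R⟦X⟧} (hF : IsLogDeriv F g) :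
    IsLogDeriv (PowerSeries.map φ F) (PowerSeries.map φ g) := by
  unfold IsLogDeriv at *
  rw [← map_mul, ← hF]
  ext N
  rw [coeff_X_mul_derivative, coeff_map, coeff_map, coeff_X_mul_derivative, _root_.map_mul,
    map_natCast]

theorem rescale (a : R) {F g : R⟦X⟧} (hF : IsLogDeriv F g) :
    IsLogDeriv (PowerSeries.rescale a F) (PowerSeries.rescale a g) := by
  unfold IsLogDeriv at *
  rw [← map_mul, ← hF]
  ext N
  rw [coeff_X_mul_derivative, coeff_rescale, coeff_rescale, coeff_X_mul_derivative]
  ring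

theorem expand (n : ℕ) (hn : n ≠ 0) {F g : R⟦X⟧} (hF : IsLogDeriv F g) :
    IsLogDeriv (PowerSeries.expand n hn F) (n * PowerSeries.expand n hn g) := by
  unfold IsLogDeriv at *
  rw [mul_assoc, ← map_mul, ← hF]
  ext N
  rw [coeff_X_mul_derivative, ← nsmul_eq_mul n, map_nsmul, coeff_expand, coeff_expand]
  split_ifs with h
  · obtain ⟨m, rfl⟩ := h
    rw [Nat.mul_div_cancel_left m (Nat.pos_of_ne_zero hn), coeff_X_mul_derivative]
    push_cast
    rw [nsmul_eq_mul]
    ring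
  · simp

/-- The defining identity in degree `N` involves only coefficients of degree at most `N`; infinite
products are thus reached through partial products. -/
theorem of_coeff {F g : R⟦X⟧} (h : ∀ N, ∃ F' g' : R⟦X⟧, IsLogDeriv F' g' ∧
    (∀ i ≤ N, coeff i F = coeff i F') ∧ ∀ i ≤ N, coeff i g = coeff i g') : IsLogDeriv F g := by
  unfold IsLogDeriv
  ext N
  obtain ⟨F', g', h1, h2, h3⟩ := h N
  rw [coeff_X_mul_derivative, h2 N le_rfl, ← coeff_X_mul_derivative, h1, coeff_mul, coeff_mul]
  refine Finset.sum_congr rfl fun i hi => ?_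
  rw [Finset.HasAntidiagonal.mem_antidiagonal] at hi
  rw [h2 _ (by omega), h3 _ (by omega)]

theorem eq_right {F g h : R⟦X⟧} (hF : constantCoeff F = 1) (hg : IsLogDeriv F g)
    (hh : IsLogDeriv F h) : g = h := by
  obtain ⟨G, hG, -⟩ := exists_mul_eq_one hF
  unfold IsLogDeriv at *
  linear_combination (h - g) * hG + G * hh - G * hg

/-- The quotient `G / F` has logarithmic derivative zero, so `N` times its coefficient of degree `N`
vanishes. This identifies exponentials without dividing by integers. -/
theorem eq_left [IsDomain R] [CharZero R] {F G g : R⟦X⟧} (hF : constantCoeff F = 1)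
    (hG : constantCoeff G = 1) (h : IsLogDeriv F g) (h' : IsLogDeriv G g) : F = G := by
  obtain ⟨I, hI, hI1⟩ := exists_mul_eq_one hF
  have h0 := h'.mul (h.of_mul_eq_one hI)
  have h1 : G * I = 1 := by
    ext N
    rcases Nat.eq_zero_or_pos N with rfl | hN
    · simp [hG, hI1]
    · have := congrArg (coeff N) h0
      rw [coeff_X_mul_derivative] at this
      simp only [add_neg_cancel, zero_mul, map_zero, mul_eq_zero, Nat.cast_eq_zero] at this
      rw [coeff_one, if_neg hN.ne']
      exact this.resolve_left hN.ne'
  linear_combination G * hI - F * h1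

theorem of_eq {F g h : R⟦X⟧} (hF : IsLogDeriv F g) (e : g = h) : IsLogDeriv F h := e ▸ hF

end IsLogDeriv

theorem expand_rescale_one_sub_X (a : R) (n : ℕ) (hn : n ≠ 0) :
    expand n hn (rescale a (1 - X)) = 1 - C a * X ^ n := by
  rw [map_sub, rescale_X, map_one, map_sub, map_mul, expand_C, expand_X, map_one]

/-- Obtained from `1 - X`, whose logarithmic derivative is `1 - 1/(1 - X)`, by the substitution `X ↦
a X ^ n`. -/
theorem isLogDeriv_one_sub_C_mul_X_pow (a : R) (n : ℕ) (hn : n ≠ 0) :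
    IsLogDeriv (1 - C a * X ^ n)
      (mk fun N => if n ∣ N ∧ N ≠ 0 then -(n * a ^ (N / n)) else 0) := by
  have h0 : IsLogDeriv (1 - X : R⟦X⟧) (1 - mk 1) := by
    unfold IsLogDeriv
    rw [sub_mul, mk_one_mul_one_sub_eq_one]
    simp
  rw [← expand_rescale_one_sub_X a n hn]
  refine ((h0.rescale a).expand n hn).of_eq ?_
  ext N
  rw [← nsmul_eq_mul, map_nsmul, coeff_expand, coeff_mk, nsmul_eq_mul]
  by_cases h : n ∣ N
  · obtain ⟨m, rfl⟩ := h
    rw [Nat.mul_div_cancel_left m (Nat.pos_of_ne_zero hn)]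
    rcases Nat.eq_zero_or_pos m with rfl | hm
    · simp [coeff_rescale, -coeff_zero_eq_constantCoeff]
    · simp [coeff_one, hm.ne', hn]
  · simp [h]

end LogDeriv

end PowerSeries

/-! ### Ghost components as logarithmic derivatives -/

namespace BigWitt

open PowerSeries

variable {A : Type*} [CommRing A]

/-- The generating series `-∑ ghost_n T ^ n`. -/
noncomputable def negGhostSeries (x : BigWitt A) : A⟦X⟧ :=
  PowerSeries.mk fun N => if 0 < N then -x.ghost N.toPNat' else 0

/-- The partial products of `toSeries`. -/
noncomputable def partialProd (x : BigWitt A) (M : ℕ) : A⟦X⟧ :=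
  ∏ n ∈ Finset.range M, (1 - C (x.coord (Nat.succPNat n)) * X ^ (n + 1))

theorem coeff_partialProd (x : BigWitt A) {N M : ℕ} (h : N ≤ M) :
    coeff N (x.partialProd M) = coeff N x.toSeries := by
  induction M, h using Nat.le_induction with
  | base => simp [toSeries, partialProd]
  | succ M hM ih =>
    rw [partialProd, Finset.prod_range_succ, mul_sub, mul_one, map_sub, ← mul_assoc,
      coeff_mul_X_pow', if_neg (by omega), sub_zero]
    exact ih

theorem ghost_eq_sum_divisors (x : BigWitt A) (n : ℕ+) :
    x.ghost n = ∑ k ∈ (n : ℕ).divisors, (k : A) * x.coord k.toPNat' ^ ((n : ℕ) / k) := by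
  simp only [ghost]
  refine Finset.sum_bij' (fun d _ => (d : ℕ)) (fun k _ => k.toPNat') ?_ ?_ ?_ ?_ ?_
  · intro d hd
    simp only [Finset.mem_filter, Finset.mem_Icc] at hd
    simp [hd.2]
  · intro k hk
    rw [Nat.mem_divisors] at hk
    have hk0 : 0 < k := Nat.pos_of_dvd_of_pos hk.1 n.pos
    simp only [Finset.mem_filter, Finset.mem_Icc, Nat.toPNat'_coe, if_pos hk0]
    refine ⟨⟨one_le, ?_⟩, hk.1⟩
    rw [← PNat.coe_le_coe, Nat.toPNat'_coe, if_pos hk0]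
    exact Nat.le_of_dvd n.pos hk.1
  · intro d _; simp
  · intro k hk
    have hk0 : 0 < k := Nat.pos_of_mem_divisors hk
    simp [hk0]
  · intro d _; simp

theorem ghost_eq_sum_range (x : BigWitt A) {N M : ℕ} (hN : 0 < N) (h : N ≤ M) :
    x.ghost N.toPNat' = ∑ k ∈ Finset.range M,
      if k + 1 ∣ N then ((k + 1 : ℕ) : A) * x.coord (Nat.succPNat k) ^ (N / (k + 1)) else 0 := by
  rw [ghost_eq_sum_divisors, ← Finset.sum_filter, Nat.toPNat'_coe, if_pos hN]
  refine Finset.sum_bij' (fun d _ => d - 1) (fun k _ => k + 1) ?_ ?_ ?_ ?_ ?_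
  · intro d hd
    have := Nat.pos_of_mem_divisors hd
    have := Nat.divisor_le hd
    simp only [Finset.mem_filter, Finset.mem_range]
    exact ⟨by omega, by rw [Nat.sub_add_cancel (by omega)]; exact Nat.dvd_of_mem_divisors hd⟩
  · intro k hk
    simp only [Finset.mem_filter, Finset.mem_range] at hk
    exact Nat.mem_divisors.2 ⟨hk.2, hN.ne'⟩
  · intro d hd
    exact Nat.sub_add_cancel (Nat.pos_of_mem_divisors hd)
  · intro k _; simp
  · intro d hd
    obtain ⟨e, rfl⟩ := Nat.exists_eq_succ_of_ne_zero (Nat.pos_of_mem_divisors hd).ne'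
    rfl

theorem isLogDeriv_toSeries (x : BigWitt A) : IsLogDeriv x.toSeries x.negGhostSeries := by
  refine IsLogDeriv.of_coeff fun N => ⟨x.partialProd N, _, IsLogDeriv.prod _ fun k _ =>
    isLogDeriv_one_sub_C_mul_X_pow _ _ k.succ_ne_zero, fun i hi => (coeff_partialProd x hi).symm,
    fun i hi => ?_⟩
  rw [negGhostSeries, coeff_mk, map_sum]
  split_ifs with h
  · rw [ghost_eq_sum_range x h hi, ← Finset.sum_neg_distrib]
    refine Finset.sum_congr rfl fun k _ => ?_
    rw [coeff_mk]
    by_cases h' : k + 1 ∣ i <;> simp [h', h.ne']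
  · symm
    refine Finset.sum_eq_zero fun k _ => ?_
    rw [coeff_mk, if_neg (by omega)]

theorem ghost_eq_neg_coeff (x : BigWitt A) {g : A⟦X⟧} (h : IsLogDeriv x.toSeries g) (n : ℕ+) :
    x.ghost n = -coeff (n : ℕ) g := by
  rw [h.eq_right (constantCoeff_toSeries x) x.isLogDeriv_toSeries, negGhostSeries, coeff_mk,
    if_pos n.pos, neg_neg, PNat.coe_toPNat']

theorem toSeries_map {B : Type*} [CommRing B] (f : A →+* B) (x : BigWitt A) :
    (x.map f).toSeries = PowerSeries.map f x.toSeries := by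
  ext N
  rw [PowerSeries.coeff_map, toSeries, toSeries, coeff_mk, coeff_mk, ← PowerSeries.coeff_map,
    map_prod (PowerSeries.map f)]
  simp [BigWitt.map]

theorem toSeries_injective : Function.Injective (toSeries : BigWitt A → A⟦X⟧) := fun _ y h =>
  (existsUnique_toSeries y.toSeries (constantCoeff_toSeries y)).unique h rfl

/-- A big Witt vector whose series has coefficients in the image of `f` has its coordinates in the
image of `f`. -/
theorem coord_mem_range_of_toSeries_eq_map {B : Type*} [CommRing B] (f : A →+* B) (x : BigWitt B)
    (F : A⟦X⟧) (hF : constantCoeff F = 1) (h : x.toSeries = PowerSeries.map f F) (n : ℕ+) :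
    ∃ a, f a = x.coord n := by
  have : (ofSeries F hF).map f = x := by
    apply toSeries_injective
    rw [toSeries_map, toSeries_ofSeries, h]
  exact ⟨(ofSeries F hF).coord n, by rw [← this]; rfl⟩

end BigWitt

theorem isLogDeriv_piExp {K : Type*} [Field K] [CharZero K] (p D : ℕ) (ζ : K) :
    PowerSeries.IsLogDeriv (piExp p D ζ) (PowerSeries.mk fun N =>
      if 1 ≤ N ∧ N ≤ D then piParam p D ζ (Nat.log p (D / N)) else 0) := by
  have hs : PowerSeries.HasSubst (piPoly p D ζ) :=
    PowerSeries.HasSubst.of_constantCoeff_zero (constantCoeff_piPoly p D ζ)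
  unfold PowerSeries.IsLogDeriv
  rw [piExp, PowerSeries.derivative_subst hs, PowerSeries.derivative_exp, mul_comm _ (PowerSeries.derivative K _),
    ← mul_assoc]
  congr 1
  ext N
  rw [PowerSeries.coeff_X_mul_derivative, PowerSeries.coeff_mk, piPoly, map_sum]
  simp only [PowerSeries.coeff_C_mul_X_pow, Finset.sum_ite_eq, Finset.mem_Icc]
  split_ifs with h
  · have : (N : K) ≠ 0 := by exact_mod_cast (by omega : N ≠ 0)
    field_simp
  · simp

/-! ### Dwork's criterion and Artin-Hasse series over the `p`-adic integers -/

section Dwork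

variable {p : ℕ} [hp : Fact p.Prime]

theorem PadicInt.dvd_pow_prime_sub_self (w : ℤ_[p]) : (p : ℤ_[p]) ∣ w ^ p - w := by
  rw [← Ideal.mem_span_singleton, ← PadicInt.maximalIdeal_eq_span_p, ← PadicInt.ker_toZMod,
    RingHom.mem_ker, map_sub, map_pow, ZMod.pow_card, sub_self]

theorem PadicInt.pow_dvd_pow_sub_pow (w : ℤ_[p]) (k m : ℕ) :
    (p : ℤ_[p]) ^ (k + 1) ∣ w ^ (p * (p ^ k * m)) - w ^ (p ^ k * m) := by
  have h := dvd_sub_pow_of_dvd_sub (PadicInt.dvd_pow_prime_sub_self (w ^ m)) k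
  rw [← pow_mul, ← pow_mul, ← pow_mul] at h
  convert h using 3 <;> ring

theorem Nat.dvd_of_dvd_prime_mul {q d n : ℕ} (hq : q.Prime) (h : d ∣ q * n)
    (hd : d.factorization q ≤ n.factorization q) : d ∣ n := by
  have h1 := Nat.ordCompl_dvd_ordCompl_of_dvd h q
  have h2 := Nat.ordCompl_self_pow (k := 1) hq
  rw [pow_one] at h2
  rw [Nat.ordCompl_mul, h2, one_mul] at h1
  rw [← Nat.ordProj_mul_ordCompl_eq_self d q, ← Nat.ordProj_mul_ordCompl_eq_self n q]
  exact mul_dvd_mul (pow_dvd_pow _ hd) h1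

/-- For `d ∣ n` the terms of index `d` differ by `d (y ^ (p m) - y ^ m)` with `n = d m`, and the two
factors contribute the valuations of `d` and of `m`, plus one. A divisor of `p n` not dividing `n`
already has valuation larger than that of `n`. -/
theorem PadicInt.pow_dvd_ghost_sub_ghost (y : ℕ → ℤ_[p]) {n : ℕ} (hn : n ≠ 0) :
    (p : ℤ_[p]) ^ (n.factorization p + 1) ∣
      ∑ d ∈ (p * n).divisors, (d : ℤ_[p]) * y d ^ (p * n / d) -
        ∑ d ∈ n.divisors, (d : ℤ_[p]) * y d ^ (n / d) := by
  have hpn : p * n ≠ 0 := mul_ne_zero hp.out.ne_zero hn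
  have h1 : ∑ d ∈ n.divisors, (d : ℤ_[p]) * y d ^ (n / d) =
      ∑ d ∈ (p * n).divisors, if d ∣ n then (d : ℤ_[p]) * y d ^ (n / d) else 0 := by
    rw [← Finset.sum_filter]
    refine Finset.sum_congr ?_ fun _ _ => rfl
    ext d
    simp only [Nat.mem_divisors, Finset.mem_filter]
    exact ⟨fun h => ⟨⟨h.1.mul_left p, hpn⟩, h.1⟩, fun h => ⟨h.2, hn⟩⟩
  rw [h1, ← Finset.sum_sub_distrib]
  refine Finset.dvd_sum fun d hd => ?_
  have hdp := Nat.dvd_of_mem_divisors hd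
  have hpd : (p : ℤ_[p]) ^ d.factorization p ∣ d := by
    exact_mod_cast (Nat.cast_dvd_cast (Nat.ordProj_dvd d p) : ((_ : ℕ) : ℤ_[p]) ∣ _)
  split_ifs with h
  · obtain ⟨m, rfl⟩ := h
    have hd0 : d ≠ 0 := left_ne_zero_of_mul hn
    have hm0 : m ≠ 0 := right_ne_zero_of_mul hn
    rw [Nat.mul_div_cancel_left m (Nat.pos_of_ne_zero hd0),
      show p * (d * m) / d = p * m by
        rw [mul_left_comm, Nat.mul_div_cancel_left _ (Nat.pos_of_ne_zero hd0)],
      Nat.factorization_mul hd0 hm0, Finsupp.add_apply, add_assoc, pow_add, ← mul_sub]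
    refine mul_dvd_mul hpd ?_
    have := PadicInt.pow_dvd_pow_sub_pow (y d) (m.factorization p) (ordCompl[p] m)
    rwa [Nat.ordProj_mul_ordCompl_eq_self] at this
  · rw [sub_zero]
    refine Dvd.dvd.mul_right ((pow_dvd_pow _ ?_).trans hpd) _
    by_contra! hlt
    exact h (Nat.dvd_of_dvd_prime_mul hp.out hdp (by omega))

theorem PadicInt.exists_natCast_mul_eq {n : ℕ} (hn : n ≠ 0) {b : ℤ_[p]}
    (h : (p : ℤ_[p]) ^ n.factorization p ∣ b) : ∃ a : ℤ_[p], b = n * a := by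
  have hu : IsUnit ((ordCompl[p] n : ℕ) : ℤ_[p]) := by
    rw [PadicInt.isUnit_iff, PadicInt.norm_natCast_eq_one_iff]
    exact Nat.coprime_ordCompl hp.out hn
  have e : (n : ℤ_[p]) = (p : ℤ_[p]) ^ n.factorization p * ((ordCompl[p] n : ℕ) : ℤ_[p]) := by
    exact_mod_cast congrArg (Nat.cast (R := ℤ_[p])) (Nat.ordProj_mul_ordCompl_eq_self n p).symm
  obtain ⟨c, rfl⟩ := h
  obtain ⟨u, hu⟩ := hu.exists_right_inv
  exact ⟨u * c, by rw [e]; linear_combination (-(p : ℤ_[p]) ^ n.factorization p * c) * hu⟩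

/-- Dwork's criterion for a sequence of `p`-adic integers to be the sequence of ghost components
of a big Witt vector over `ℤ_[p]`. -/
theorem PadicInt.exists_bigWitt_ghost_eq (g : ℕ+ → ℤ_[p])
    (hg : ∀ n m : ℕ+, (m : ℕ) = p * n →
      (p : ℤ_[p]) ^ ((n : ℕ).factorization p + 1) ∣ g m - g n) :
    ∃ x : BigWitt ℤ_[p], x.ghost = g := by
  obtain ⟨z, hz⟩ := (BigWitt.ghost_bijective ℚ_[p]).2 fun n => (g n : ℚ_[p])
  have hz' := fun n => congrFun hz n
  simp only [BigWitt.ghost_eq_sum_divisors] at hz'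
  -- The default `0` makes `y` total; `hint` shows that it is never taken at a positive index.
  let y : ℕ → ℤ_[p] := fun d =>
    if h : ‖z.coord d.toPNat'‖ ≤ 1 then ⟨z.coord d.toPNat', h⟩ else 0
  have hy : ∀ d : ℕ+, ‖z.coord d‖ ≤ 1 → (y d : ℚ_[p]) = z.coord d := by
    intro d hd
    have : ‖z.coord (d : ℕ).toPNat'‖ ≤ 1 := by simpa using hd
    simp [y, hd]
  have hsum : ∀ n : ℕ+, (∀ d ≤ n, ‖z.coord d‖ ≤ 1) →
      ∑ d ∈ (n : ℕ).divisors, (d : ℤ_[p]) * y d ^ ((n : ℕ) / d) = g n := by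
    intro n hn
    apply PadicInt.ext
    rw [← hz' n, PadicInt.coe_sum]
    push_cast
    refine Finset.sum_congr rfl fun d hd => ?_
    have hd0 := Nat.pos_of_mem_divisors hd
    have hdn : d.toPNat' ≤ n := by
      rw [← PNat.coe_le_coe, Nat.toPNat'_coe, if_pos hd0]
      exact Nat.divisor_le hd
    have := hy _ (hn _ hdn)
    rw [Nat.toPNat'_coe, if_pos hd0] at this
    rw [this]
  have hint : ∀ n : ℕ+, ‖z.coord n‖ ≤ 1 := by
    intro n
    induction n using PNat.strongInductionOn with
    | _ n ih =>
    have hn0 : (n : ℕ) ≠ 0 := n.ne_zero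
    obtain ⟨a, ha⟩ : ∃ a : ℤ_[p],
        g n - ∑ d ∈ (n : ℕ).properDivisors, (d : ℤ_[p]) * y d ^ ((n : ℕ) / d) = n * a := by
      apply PadicInt.exists_natCast_mul_eq hn0
      -- For `n = p m`, the hypothesis on `g`, the congruence of ghost sums and the induction at `m`
      -- give the divisibility. Only `p` matters, other primes being units.
      by_cases hpn : p ∣ n
      · obtain ⟨m, hm⟩ := hpn
        lift m to ℕ+ using Nat.pos_of_ne_zero fun h => hn0 (by rw [hm, h, mul_zero])
        have hv : (n : ℕ).factorization p = (m : ℕ).factorization p + 1 := by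
          rw [hm, Nat.factorization_mul hp.out.ne_zero m.ne_zero]
          simp [hp.out.factorization_self, add_comm]
        have h1 := PadicInt.pow_dvd_ghost_sub_ghost y m.ne_zero
        have h2 := hg m n hm
        have hlt : m < n := by
          rw [← PNat.coe_lt_coe, hm]
          exact lt_mul_left m.pos hp.out.one_lt
        have h3 := hsum m fun d hd => ih d (lt_of_le_of_lt hd hlt)
        rw [← hm, ← hv, h3, ← Nat.insert_self_properDivisors hn0,
          Finset.sum_insert Nat.self_notMem_properDivisors] at h1
        rw [← hv] at h2
        have h4 : (p : ℤ_[p]) ^ (n : ℕ).factorization p ∣ ((n : ℕ) : ℤ_[p]) := by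
          exact_mod_cast (Nat.cast_dvd_cast (Nat.ordProj_dvd n p) : ((_ : ℕ) : ℤ_[p]) ∣ _)
        convert (h2.sub h1).add (h4.mul_right (y n ^ ((n : ℕ) / n))) using 1
        ring
      · rw [Nat.factorization_eq_zero_of_not_dvd hpn, pow_zero]
        exact one_dvd _
    have h5 := hz' n
    rw [← Nat.insert_self_properDivisors hn0,
      Finset.sum_insert Nat.self_notMem_properDivisors, Nat.div_self n.pos, pow_one] at h5
    have h6 : ∑ d ∈ (n : ℕ).properDivisors, (d : ℚ_[p]) * z.coord d.toPNat' ^ ((n : ℕ) / d) =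
        ((∑ d ∈ (n : ℕ).properDivisors, (d : ℤ_[p]) * y d ^ ((n : ℕ) / d) : ℤ_[p]) : ℚ_[p]) := by
      rw [PadicInt.coe_sum]
      push_cast
      refine Finset.sum_congr rfl fun d hd => ?_
      have hd' := Nat.mem_properDivisors.1 hd
      have hd0 := Nat.pos_of_mem_properDivisors hd
      have hdn : d.toPNat' < n := by
        rw [← PNat.coe_lt_coe, Nat.toPNat'_coe, if_pos hd0]
        exact hd'.2
      have := hy _ (ih _ hdn)
      rw [Nat.toPNat'_coe, if_pos hd0] at this
      rw [this]
    rw [h6] at h5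
    have h7 : (n : ℚ_[p]) * z.coord n = (n : ℚ_[p]) * a := by
      have := congrArg (Subtype.val) ha
      push_cast at this
      have e : z.coord (n : ℕ).toPNat' = z.coord n := by simp
      rw [e] at h5
      linear_combination h5 + this
    rw [mul_left_cancel₀ (by exact_mod_cast hn0) h7]
    exact a.2
  refine ⟨⟨fun n => y n⟩, funext fun n => ?_⟩
  rw [BigWitt.ghost_eq_sum_divisors, ← hsum n fun d _ => hint d]
  refine Finset.sum_congr rfl fun d hd => ?_
  have hd0 := Nat.pos_of_mem_divisors hd
  simp [hd0]

/-- The series `exp (∑_{k} T ^ (m p ^ k) / (m p ^ k))`, for `m` prime to `p`, has coefficients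
in `ℤ_[p]`. -/
theorem PadicInt.exists_artinHasse (m : ℕ) : ∃ F : ℤ_[p]⟦X⟧,
    PowerSeries.constantCoeff F = 1 ∧ F.IsLogDeriv
      (PowerSeries.mk fun N => if 0 < N ∧ ordCompl[p] N = m then 1 else 0) := by
  obtain ⟨x, hx⟩ := PadicInt.exists_bigWitt_ghost_eq (p := p)
    (fun n => if ordCompl[p] (n : ℕ) = m then -1 else 0) (by
      intro n k hk
      have : ordCompl[p] (k : ℕ) = ordCompl[p] (n : ℕ) := by
        rw [hk]
        simpa using Nat.ordCompl_self_pow_mul (n : ℕ) 1 hp.out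
      simp only [this, sub_self, dvd_zero])
  refine ⟨x.toSeries, x.constantCoeff_toSeries, x.isLogDeriv_toSeries.of_eq ?_⟩
  ext N
  rw [BigWitt.negGhostSeries, hx, PowerSeries.coeff_mk, PowerSeries.coeff_mk]
  by_cases h0 : 0 < N <;> by_cases h1 : ordCompl[p] N = m <;> simp [h0, h1]

end Dwork

/-! ### Integrality of the exponentials attached to roots of unity -/

section PiUnit

variable {p : ℕ} [hp : Fact p.Prime]

theorem Nat.log_div_pow_mul (b M m k : ℕ) :
    Nat.log b (M / (b ^ k * m)) = Nat.log b (M / m) - k := by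
  rw [mul_comm, ← Nat.div_div_eq_div_mul, Nat.log_div_base_pow]

/-- Along the exponents `p ^ k * m` the parameters `ζ_j - 1` are those of successive `p`-th powers
of one root of unity, which becomes `1` exactly when `M` is exceeded. This lets a truncated sum be
treated as an infinite one. -/
theorem pow_pow_add_sub_one_of_log {R : Type*} [CommRing R] {ζ : R} {M m : ℕ}
    (hζ : ζ ^ p ^ (Nat.log p M + 1) = 1) (hm : 0 < m) (hmM : m ≤ M) (k : ℕ) :
    ζ ^ p ^ (Nat.log p M - Nat.log p (M / m) + k) - 1 =
      if p ^ k * m ≤ M then ζ ^ p ^ (Nat.log p M - Nat.log p (M / (p ^ k * m))) - 1 else 0 := by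
  have hle : Nat.log p (M / m) ≤ Nat.log p M := Nat.log_mono_right (Nat.div_le_self _ _)
  split_ifs with h
  · have hk : k ≤ Nat.log p (M / m) :=
      Nat.le_log_of_pow_le hp.out.one_lt ((Nat.le_div_iff_mul_le hm).2 h)
    rw [Nat.log_div_pow_mul]
    congr 3
    omega
  · have hk : Nat.log p (M / m) < k := by
      by_contra! hk
      exact h ((Nat.le_div_iff_mul_le hm).1
        (Nat.pow_le_of_le_log (Nat.div_pos hmM hm).ne' hk))
    obtain ⟨r, hr⟩ := Nat.exists_eq_add_of_le
      (show Nat.log p M + 1 ≤ Nat.log p M - Nat.log p (M / m) + k by omega)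
    rw [hr, pow_add, pow_mul, hζ, one_pow, sub_self]

theorem exists_pow_mul_eq_self {R : Type*} [CommRing R] {ζ : R} {e m : ℕ}
    (hζ : ζ ^ p ^ (e + 1) = 1) (hm : ¬ p ∣ m) : ∃ c : ℕ, ζ ^ (m * c) = ζ := by
  obtain ⟨c, -, hc⟩ := Nat.exists_mul_mod_eq_one_of_coprime (n := m) (k := p ^ (e + 1))
    (((Nat.Prime.coprime_iff_not_dvd hp.out).2 hm).symm.pow_right _)
    (Nat.one_lt_pow e.succ_ne_zero hp.out.one_lt)
  exact ⟨c, by rw [pow_eq_pow_mod _ hζ, hc, pow_one]⟩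

variable {R : Type*} [CommRing R] [Algebra ℤ_[p] R]

/-- The series is `B(ηT) / B(T)` with `B` of Artin-Hasse type: its logarithmic derivative has
coefficients `η ^ N - 1`. Modulo `ζ - 1` one has `η = 1`, so the quotient is `1`. -/
theorem exists_isLogDeriv_ordCompl {ζ : R} {M m : ℕ} (hm : 0 < m) (hmM : m ≤ M)
    (hζ : ζ ^ p ^ (Nat.log p M + 1) = 1) : ∃ V : R⟦X⟧,
      PowerSeries.constantCoeff V = 1 ∧
      V.IsLogDeriv (PowerSeries.mk fun N => if (1 ≤ N ∧ N ≤ M) ∧ ordCompl[p] N = m then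
        ζ ^ p ^ (Nat.log p M - Nat.log p (M / N)) - 1 else 0) ∧
      PowerSeries.map (Ideal.Quotient.mk (Ideal.span {ζ - 1})) V = 1 := by
  by_cases hpm : p ∣ m
  · refine ⟨1, by simp, PowerSeries.IsLogDeriv.one.of_eq ?_, by simp⟩
    ext N
    rw [PowerSeries.coeff_mk, if_neg, map_zero]
    rintro ⟨⟨h1, -⟩, rfl⟩
    exact Nat.not_dvd_ordCompl hp.out (by omega) hpm
  obtain ⟨c, hc⟩ := exists_pow_mul_eq_self hζ hpm
  set e := Nat.log p M - Nat.log p (M / m) with he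
  -- As `c` inverts `m` modulo the order of `ζ`, this `η` is an `m`-th root of `ζ ^ p ^ e`.
  set η := ζ ^ (c * p ^ e) with hη
  obtain ⟨A, hA1, hA⟩ := PadicInt.exists_artinHasse (p := p) m
  set B := PowerSeries.map (algebraMap ℤ_[p] R) A with hB
  have hB1 : PowerSeries.constantCoeff B = 1 := by
    rw [hB, ← PowerSeries.coeff_zero_eq_constantCoeff_apply, PowerSeries.coeff_map,
      PowerSeries.coeff_zero_eq_constantCoeff_apply, hA1, map_one]
  obtain ⟨B', hBB', hB'1⟩ := PowerSeries.exists_mul_eq_one hB1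
  have hBd := hA.map (algebraMap ℤ_[p] R)
  refine ⟨PowerSeries.rescale η B * B', ?_, ?_, ?_⟩
  · rw [map_mul, hB'1, mul_one, ← PowerSeries.coeff_zero_eq_constantCoeff_apply,
      PowerSeries.coeff_rescale, pow_zero, one_mul, PowerSeries.coeff_zero_eq_constantCoeff_apply,
      hB1]
  · refine ((hBd.rescale η).mul (hBd.of_mul_eq_one hBB')).of_eq ?_
    ext N
    simp only [map_add, map_neg, PowerSeries.coeff_rescale, PowerSeries.coeff_map,
      PowerSeries.coeff_mk]
    by_cases h : 0 < N ∧ ordCompl[p] N = m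
    · have hN : N = p ^ N.factorization p * m := by
        conv_lhs => rw [← Nat.ordProj_mul_ordCompl_eq_self N p, h.2]
      have hηN : η ^ N = ζ ^ p ^ (e + N.factorization p) := by
        rw [hη, ← pow_mul, show c * p ^ e * N = m * c * p ^ (e + N.factorization p) by
          conv_lhs => rw [hN]
          ring, pow_mul, hc]
      have key := pow_pow_add_sub_one_of_log hζ hm hmM (N.factorization p)
      rw [← hN] at key
      rw [if_pos h, map_one, mul_one, hηN, ← sub_eq_add_neg, key]
      by_cases hNM : N ≤ M
      · rw [if_pos hNM, if_pos ⟨⟨h.1, hNM⟩, h.2⟩]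
      · rw [if_neg hNM, if_neg fun h' => hNM h'.1.2]
    · rw [if_neg h, map_zero, mul_zero, neg_zero, add_zero, if_neg fun h' => h ⟨h'.1.1, h'.2⟩]
  · have h1 : Ideal.Quotient.mk (Ideal.span {ζ - 1}) ζ = 1 := by
      rw [← map_one (Ideal.Quotient.mk _), Ideal.Quotient.mk_eq_mk_iff_sub_mem]
      exact Ideal.mem_span_singleton_self _
    rw [map_mul, ← PowerSeries.rescale_map, hη, map_pow, h1, one_pow, PowerSeries.rescale_one,
      RingHom.id_apply, ← map_mul, hBB', map_one]

/-- The series `exp (∑_{1 ≤ k ≤ M} (ζ_k - 1) T ^ k / k)`, where `ζ_k` is the power of `ζ` of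
exponent `p ^ (⌊log_p M⌋ - ⌊log_p (M / k)⌋)`, has coefficients in the ring generated by `ζ`. -/
theorem exists_isLogDeriv_of_pow_eq_one {ζ : R} {M : ℕ}
    (hζ : ζ ^ p ^ (Nat.log p M + 1) = 1) : ∃ U : R⟦X⟧,
      PowerSeries.constantCoeff U = 1 ∧
      U.IsLogDeriv (PowerSeries.mk fun N => if 1 ≤ N ∧ N ≤ M then
        ζ ^ p ^ (Nat.log p M - Nat.log p (M / N)) - 1 else 0) ∧
      PowerSeries.map (Ideal.Quotient.mk (Ideal.span {ζ - 1})) U = 1 := by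
  have : ∀ m : ℕ, ∃ V : R⟦X⟧, m ∈ Finset.Icc 1 M → PowerSeries.constantCoeff V = 1 ∧
      V.IsLogDeriv (PowerSeries.mk fun N => if (1 ≤ N ∧ N ≤ M) ∧ ordCompl[p] N = m then
        ζ ^ p ^ (Nat.log p M - Nat.log p (M / N)) - 1 else 0) ∧
      PowerSeries.map (Ideal.Quotient.mk (Ideal.span {ζ - 1})) V = 1 := by
    intro m
    by_cases hm : m ∈ Finset.Icc 1 M
    · obtain ⟨V, hV⟩ := exists_isLogDeriv_ordCompl (Finset.mem_Icc.1 hm).1 (Finset.mem_Icc.1 hm).2 hζ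
      exact ⟨V, fun _ => hV⟩
    · exact ⟨1, fun h => absurd h hm⟩
  choose V hV using this
  refine ⟨∏ m ∈ Finset.Icc 1 M, V m, ?_, ?_, ?_⟩
  · rw [map_prod]
    exact Finset.prod_eq_one fun m hm => (hV m hm).1
  · refine (PowerSeries.IsLogDeriv.prod _ fun m hm => (hV m hm).2.1).of_eq ?_
    ext N
    simp only [map_sum, PowerSeries.coeff_mk]
    by_cases hN : 1 ≤ N ∧ N ≤ M
    · have hmem : ordCompl[p] N ∈ Finset.Icc 1 M := Finset.mem_Icc.2
        ⟨Nat.ordCompl_pos p (by omega), (Nat.ordCompl_le N p).trans hN.2⟩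
      simp only [hN, and_self, true_and, if_true]
      rw [Finset.sum_ite_eq, if_pos hmem]
    · simp [hN]
  · rw [map_prod]
    exact Finset.prod_eq_one fun m hm => (hV m hm).2.2

end PiUnit

/-! ### The Artin-Schreier equation `z - z ^ p = h` -/

section ArtinSchreier

/-- If `z ≠ 0` has lowest degree `l` and highest degree `L`, then `h` is nonzero in degrees `l` and
`p * L`. So `D < p * l ≤ p * L ≤ D`, which is absurd. -/
theorem Polynomial.eq_zero_of_sub_pow_eq {k : Type*} [CommRing k] [IsDomain k] {p D : ℕ}
    (hp : 1 < p) {z h : Polynomial k} (hz : z.coeff 0 = 0) (hzh : z - z ^ p = h)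
    (hlarge : ∀ N, D < N → h.coeff N = 0) (hsmall : ∀ N, p * N ≤ D → h.coeff N = 0) : h = 0 := by
  by_cases hz0 : z = 0
  · rw [← hzh, hz0, zero_pow (by omega), sub_zero]
  exfalso
  have hl : z.natTrailingDegree ≠ 0 := by
    intro h0
    have := Polynomial.trailingCoeff_nonzero_iff_nonzero.2 hz0
    rw [Polynomial.trailingCoeff, h0] at this
    exact this hz
  have hle := Polynomial.natTrailingDegree_le_natDegree z
  have h1 : h.coeff z.natTrailingDegree ≠ 0 := by
    have hX : Polynomial.X ^ z.natTrailingDegree ∣ z := Polynomial.X_pow_dvd_iff.2 fun d hd =>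
      Polynomial.coeff_eq_zero_of_lt_natTrailingDegree hd
    have hXp := pow_dvd_pow_of_dvd hX p
    rw [← pow_mul] at hXp
    rw [← hzh, Polynomial.coeff_sub, Polynomial.X_pow_dvd_iff.1 hXp _
      (lt_mul_right (Nat.pos_of_ne_zero hl) hp), sub_zero]
    exact Polynomial.trailingCoeff_nonzero_iff_nonzero.2 hz0
  have h2 : h.coeff (p * z.natDegree) ≠ 0 := by
    rw [← hzh, Polynomial.coeff_sub, Polynomial.coeff_eq_zero_of_natDegree_lt (p := z), zero_sub,
      neg_ne_zero, ← Polynomial.natDegree_pow, Polynomial.coeff_natDegree,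
      Polynomial.leadingCoeff_pow]
    · exact pow_ne_zero _ (Polynomial.leadingCoeff_ne_zero.2 hz0)
    · exact lt_mul_left (by omega) hp
  have h3 : D < p * z.natTrailingDegree := by
    by_contra! h3
    exact h1 (hsmall _ h3)
  have h4 : p * z.natDegree ≤ D := by
    by_contra! h4
    exact h2 (hlarge _ h4)
  have := Nat.mul_le_mul_left p hle
  omega

/-- The subring of the power series which are polynomials modulo the ideal `J`. -/
noncomputable def PowerSeries.polynomialMod {R : Type*} [CommRing R] (J : Ideal R) :
    Subring R⟦X⟧ :=
  (Polynomial.coeToPowerSeries.ringHom (R := R ⧸ J)).range.comap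
    (PowerSeries.map (Ideal.Quotient.mk J))

theorem PowerSeries.exists_polynomial_of_eventually {R : Type*} [CommRing R] {F : R⟦X⟧}
    (h : ∀ᶠ i in atTop, coeff i F = 0) : ∃ P : Polynomial R, (P : R⟦X⟧) = F := by
  obtain ⟨N, hN⟩ := eventually_atTop.1 h
  refine ⟨trunc N F, ?_⟩
  ext i
  rw [Polynomial.coeff_coe, coeff_trunc]
  split_ifs with hi
  · rfl
  · exact (hN i (by omega)).symm

theorem PowerSeries.mem_polynomialMod {R : Type*} [CommRing R] {J : Ideal R} {F : R⟦X⟧} :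
    F ∈ polynomialMod J ↔ ∀ᶠ i in atTop, coeff i F ∈ J := by
  have key : ∀ i, coeff i F ∈ J ↔ coeff i (PowerSeries.map (Ideal.Quotient.mk J) F) = 0 :=
    fun i => by rw [coeff_map, Ideal.Quotient.eq_zero_iff_mem]
  simp only [key]
  constructor
  · rintro ⟨P, hP⟩
    rw [← hP]
    refine eventually_atTop.2 ⟨P.natDegree + 1, fun i hi => ?_⟩
    exact (Polynomial.coeff_coe P i).trans (Polynomial.coeff_eq_zero_of_natDegree_lt hi)
  · exact fun h => exists_polynomial_of_eventually h

theorem exists_one_add_pow_prime_eq {R : Type*} [CommRing R] {p : ℕ} (hp : p.Prime) (y : R) :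
    ∃ t, (1 + y) ^ p = 1 + y ^ p + p * y + p * y ^ 2 * t := by
  obtain ⟨q, rfl⟩ : ∃ q, p = q + 2 := ⟨p - 2, by have := hp.two_le; omega⟩
  have hd : ((q + 2 : ℕ) : R) * y ^ 2 ∣ ∑ k ∈ Finset.range q, y ^ (k + 1 + 1) *
      1 ^ (q + 2 - (k + 1 + 1)) * ((q + 2).choose (k + 1 + 1) : R) := by
    refine Finset.dvd_sum fun k hk => ?_
    rw [Finset.mem_range] at hk
    rw [one_pow, mul_one, mul_comm]
    refine mul_dvd_mul (pow_dvd_pow _ (by omega)) ?_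
    exact_mod_cast Nat.cast_dvd_cast (hp.dvd_choose_self (by omega) (by omega))
  obtain ⟨t, ht⟩ := hd
  refine ⟨t, ?_⟩
  rw [add_comm 1 y, add_pow, Finset.sum_range_succ, Finset.sum_range_succ',
    Finset.sum_range_succ', ht]
  simp
  ring

variable {R : Type*} [CommRing R] [IsDomain R]

open PowerSeries in
-- Here `E` plays the role of `exp (π X)`, and `E.subst h` that of `exp (π h)`.
theorem PowerSeries.IsLogDeriv.subst_exp {E h : R⟦X⟧} {π : R} (hE : E.IsLogDeriv (C π * X))
    (hh : constantCoeff h = 0) : IsLogDeriv (E.subst h) (X * d⁄dX R (C π * h)) := by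
  have hs : HasSubst h := HasSubst.of_constantCoeff_zero hh
  have h1 : d⁄dX R E = π • E := by
    unfold IsLogDeriv at hE
    apply mul_left_cancel₀ (X_ne_zero (R := R))
    rw [hE, smul_eq_C_mul]
    ring
  unfold IsLogDeriv
  rw [derivative_subst hs, h1, subst_smul hs, ← smul_eq_C_mul, Derivation.map_smul, smul_eq_C_mul,
    smul_eq_C_mul]
  ring

open PowerSeries in
theorem PowerSeries.exists_eq_one_add_C_mul {E : R⟦X⟧} {π : R} (hπ : π ≠ 0)
    (hE1 : constantCoeff E = 1) (hE : E.IsLogDeriv (C π * X))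
    (hEm : PowerSeries.map (Ideal.Quotient.mk (Ideal.span {π})) E = 1) :
    ∃ q : R⟦X⟧, E = 1 + C π * (X + X ^ 2 * q) := by
  have h1 : ∀ i, ∃ a, coeff i (E - 1) = π * a := by
    intro i
    have := congrArg (coeff i) hEm
    rw [← map_one (PowerSeries.map (Ideal.Quotient.mk (Ideal.span {π}))), coeff_map, coeff_map,
      Ideal.Quotient.mk_eq_mk_iff_sub_mem, Ideal.mem_span_singleton] at this
    obtain ⟨a, ha⟩ := this
    exact ⟨a, by rw [map_sub, ha]⟩
  choose a ha using h1
  have he : E = 1 + C π * mk a := by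
    ext i
    rw [map_add, coeff_C_mul, coeff_mk, ← ha, map_sub]
    ring
  have ha0 : a 0 = 0 := by
    have := ha 0
    rw [map_sub, coeff_zero_eq_constantCoeff_apply, hE1] at this
    simpa [hπ] using this.symm
  have ha1 : a 1 = 1 := by
    have h2 := congrArg (coeff 1) hE
    rw [coeff_X_mul_derivative, mul_assoc, coeff_C_mul, show (1 : ℕ) = 0 + 1 from rfl,
      coeff_succ_X_mul, coeff_zero_eq_constantCoeff_apply, hE1] at h2
    have h3 := ha 1
    rw [map_sub, coeff_one, if_neg one_ne_zero, sub_zero] at h3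
    rw [zero_add, h3] at h2
    exact mul_left_cancel₀ hπ (by simpa using h2)
  refine ⟨mk fun i => a (i + 2), ?_⟩
  rw [he]
  congr 2
  ext i
  rw [coeff_mk, map_add, coeff_X_pow_mul', coeff_X]
  rcases i with _ | _ | i
  · simp [ha0]
  · simp [ha1]
  · simp

open PowerSeries in
-- Write `F = E(h) = 1 + π z`. If `F` were a polynomial modulo `J`, then `z` would be one modulo
-- `m`, and `F ^ p = E(p h)` reduces to `z - z ^ p = h` modulo `m`, which the support of `h`
-- forbids.
theorem PowerSeries.not_eventually_mem_of_isLogDeriv [CharZero R] {p D : ℕ} (hp : p.Prime)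
    {π : R} (hπ0 : π ≠ 0) (hπ1 : (1 + π) ^ p = 1)
    {m J : Ideal R} [m.IsPrime] (hπm : π ∈ m) (hpm : (p : R) ∈ m)
    (hJ : ∀ z, π * z ∈ J → z ∈ m) {E : R⟦X⟧}
    (hE1 : constantCoeff E = 1) (hE : E.IsLogDeriv (C π * X))
    (hEm : PowerSeries.map (Ideal.Quotient.mk (Ideal.span {π})) E = 1)
    {F h : R⟦X⟧} (hF1 : constantCoeff F = 1) (hF : F.IsLogDeriv (X * d⁄dX R (C π * h)))
    (hh0 : constantCoeff h = 0) (hlarge : ∀ N, D < N → coeff N h ∈ m)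
    (hsmall : ∀ N, p * N ≤ D → coeff N h ∈ m) (hne : ∃ N, coeff N h ∉ m) :
    ¬ ∀ᶠ i in atTop, coeff i F ∈ J := by
  intro hFJ
  have hp0 : (p : R) ≠ 0 := Nat.cast_ne_zero.2 hp.ne_zero
  obtain ⟨q, hq⟩ := exists_eq_one_add_C_mul hπ0 hE1 hE hEm
  have hsub : ∀ g : R⟦X⟧, constantCoeff g = 0 →
      E.subst g = 1 + C π * (g + g ^ 2 * q.subst g) := by
    intro g hg
    have hs : HasSubst g := HasSubst.of_constantCoeff_zero hg
    rw [hq, ← coe_substAlgHom hs, map_add, map_one, map_mul, map_add, map_mul, map_pow,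
      coe_substAlgHom hs, subst_X hs]
    rw [show subst g (C π) = C π from subst_C π]
  have hconst : ∀ g : R⟦X⟧, constantCoeff g = 0 → constantCoeff (E.subst g) = 1 := by
    intro g hg
    rw [hsub g hg]
    simp [hg]
  set z := h + h ^ 2 * q.subst h with hz
  have hFz : F = 1 + C π * z := by
    rw [← hsub h hh0]
    exact hF.eq_left hF1 (hconst h hh0) (hE.subst_exp hh0)
  have hph : constantCoeff (C (p : R) * h) = 0 := by simp [hh0]
  have hFp : F ^ p = E.subst (C (p : R) * h) := by
    refine (hF.pow p).eq_left (by rw [map_pow, hF1, one_pow]) (hconst _ hph)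
      ((hE.subst_exp hph).of_eq ?_)
    rw [mul_left_comm, ← smul_eq_C_mul (C π * h), Derivation.map_smul, smul_eq_C_mul, map_natCast]
    ring
  obtain ⟨t, ht⟩ := exists_one_add_pow_prime_eq hp (C π * z)
  obtain ⟨t', ht'⟩ := exists_one_add_pow_prime_eq hp π
  -- Since `(1 + π) ^ p = 1`, the power `π ^ p` is `-p π` up to a factor congruent to `1` modulo
  -- `π`; this makes `z ^ p` appear with coefficient `-1`.
  have hπp : (C π : R⟦X⟧) ^ p = -(p * C π * (1 + C π * C t')) := by
    have h1 : π ^ p = -(p * π * (1 + π * t')) := by linear_combination hπ1 - ht'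
    rw [← map_pow, h1]
    simp
  rw [← hFz, hFp, hsub _ hph, mul_pow (C π) z, hπp, map_natCast] at ht
  set q' := subst ((p : R⟦X⟧) * h) q
  -- This is `F ^ p = E(p h)` divided by `p π`.
  have hcancel : z - z ^ p + C π * (z ^ 2 * t - C t' * z ^ p) = h + p * (h ^ 2 * q') := by
    have hne : (p : R⟦X⟧) * C π ≠ 0 := by
      rw [← map_natCast (C (R := R)), ← map_mul]
      intro h0
      rw [← map_zero (C (R := R))] at h0
      exact mul_ne_zero hp0 hπ0 (C_injective h0)
    apply mul_left_cancel₀ hne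
    linear_combination -ht
  have hzm : ∀ᶠ i in atTop, coeff i (PowerSeries.map (Ideal.Quotient.mk m) z) = 0 := by
    filter_upwards [hFJ, eventually_gt_atTop 0] with i hi hi0
    rw [coeff_map, Ideal.Quotient.eq_zero_iff_mem]
    apply hJ
    rw [hFz, map_add, coeff_one, if_neg hi0.ne', zero_add, coeff_C_mul] at hi
    exact hi
  have hhm : ∀ᶠ i in atTop, coeff i (PowerSeries.map (Ideal.Quotient.mk m) h) = 0 := by
    filter_upwards [eventually_gt_atTop D] with i hi
    rw [coeff_map, Ideal.Quotient.eq_zero_iff_mem]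
    exact hlarge i hi
  obtain ⟨Z, hZ⟩ := exists_polynomial_of_eventually hzm
  obtain ⟨H, hH⟩ := exists_polynomial_of_eventually hhm
  have hHc : ∀ N, H.coeff N = Ideal.Quotient.mk m (coeff N h) := fun N => by
    rw [← Polynomial.coeff_coe, hH, coeff_map]
  have hπm' : Ideal.Quotient.mk m π = 0 := Ideal.Quotient.eq_zero_iff_mem.2 hπm
  have hpm' : PowerSeries.map (Ideal.Quotient.mk m) (p : R⟦X⟧) = 0 := by
    rw [← map_natCast (C (R := R)), map_C, Ideal.Quotient.eq_zero_iff_mem.2 hpm, map_zero]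
  have hZH : Z - Z ^ p = H := by
    apply Polynomial.coe_injective
    have := congrArg (PowerSeries.map (Ideal.Quotient.mk m)) hcancel
    simp only [map_add, map_sub, map_mul, map_pow, map_C, hπm', map_zero, zero_mul, add_zero,
      hpm'] at this
    rw [Polynomial.coe_sub, Polynomial.coe_pow, hZ, hH, this]
  have hZ0 : Z.coeff 0 = 0 := by
    rw [← Polynomial.coeff_coe, hZ, coeff_map, hz, coeff_zero_eq_constantCoeff_apply]
    simp [hh0]
  have hH0 := Polynomial.eq_zero_of_sub_pow_eq hp.one_lt hZ0 hZH (D := D)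
    (fun N hN => by rw [hHc, Ideal.Quotient.eq_zero_iff_mem]; exact hlarge N hN)
    (fun N hN => by rw [hHc, Ideal.Quotient.eq_zero_iff_mem]; exact hsmall N hN)
  obtain ⟨N, hN⟩ := hne
  apply hN
  rw [← Ideal.Quotient.eq_zero_iff_mem, ← hHc, hH0, Polynomial.coeff_zero]

end ArtinSchreier

/-! ### The product of the `U_n (u_n T ^ n)` and its reductions -/

section WittProd

variable {p : ℕ} {R : Type*} [CommRing R]

/-- The element `ζ_j - 1`, where `ζ_j = ζ ^ (p ^ (⌊log_p D⌋ - j))`. -/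
def zetaParam (p D : ℕ) (ζ : R) (j : ℕ) : R :=
  ζ ^ p ^ (Nat.log p D - j) - 1

theorem sub_one_dvd_zetaParam (p D : ℕ) (ζ : R) (j : ℕ) : ζ - 1 ∣ zetaParam p D ζ j := by
  simpa [zetaParam] using sub_dvd_pow_sub_pow ζ 1 (p ^ (Nat.log p D - j))

/-- Since `⌊⌊D / n⌋ / k⌋ = ⌊D / (n k)⌋`, this is the integrality statement for `M = D / n` and a
suitable power of `ζ`. -/
theorem exists_isLogDeriv_zetaParam [Fact p.Prime] [Algebra ℤ_[p] R] {D : ℕ} {ζ : R}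
    (hζ : ζ ^ p ^ (Nat.log p D + 1) = 1) (n : ℕ+) : ∃ U : R⟦X⟧,
      PowerSeries.constantCoeff U = 1 ∧
      U.IsLogDeriv (PowerSeries.mk fun k => if 1 ≤ k ∧ k ≤ D / n then
        zetaParam p D ζ (Nat.log p (D / (n * k))) else 0) ∧
      PowerSeries.map (Ideal.Quotient.mk (Ideal.span {ζ - 1})) U = 1 := by
  have hle : Nat.log p (D / n) ≤ Nat.log p D := Nat.log_mono_right (Nat.div_le_self _ _)
  set ζ' := ζ ^ p ^ (Nat.log p D - Nat.log p (D / n)) with hζ'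
  have h1 : ζ' ^ p ^ (Nat.log p (D / n) + 1) = 1 := by
    rw [hζ', ← pow_mul, ← pow_add, show Nat.log p D - Nat.log p (D / n) +
      (Nat.log p (D / n) + 1) = Nat.log p D + 1 by omega, hζ]
  obtain ⟨U, hU1, hU, hUm⟩ := exists_isLogDeriv_of_pow_eq_one h1
  refine ⟨U, hU1, hU.of_eq ?_, ?_⟩
  · ext k
    rw [PowerSeries.coeff_mk, PowerSeries.coeff_mk, zetaParam, ← Nat.div_div_eq_div_mul]
    have hle' : Nat.log p (D / n / k) ≤ Nat.log p (D / n) :=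
      Nat.log_mono_right (Nat.div_le_self _ _)
    rw [hζ', ← pow_mul, ← pow_add, show Nat.log p D - Nat.log p (D / n) +
      (Nat.log p (D / n) - Nat.log p (D / n / k)) = Nat.log p D - Nat.log p (D / n / k) by omega]
  · have hle : Ideal.span {ζ' - 1} ≤ Ideal.span {ζ - 1} := by
      rw [Ideal.span_singleton_le_span_singleton]
      exact sub_one_dvd_zetaParam p D ζ _
    have := congrArg (PowerSeries.map (Ideal.Quotient.factor hle)) hUm
    rw [map_one] at this
    rw [← this]
    ext i
    simp

/-- The product of the series `U_n (u_n T ^ n)`. -/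
noncomputable def wittProd (u : ℕ+ → R) (U : ℕ+ → R⟦X⟧) (S : Finset ℕ+) : R⟦X⟧ :=
  ∏ n ∈ S, PowerSeries.expand n n.ne_zero (PowerSeries.rescale (u n) (U n))

theorem constantCoeff_wittProd (u : ℕ+ → R) {U : ℕ+ → R⟦X⟧}
    (hU : ∀ n, PowerSeries.constantCoeff (U n) = 1) (S : Finset ℕ+) :
    PowerSeries.constantCoeff (wittProd u U S) = 1 := by
  rw [wittProd, map_prod]
  refine Finset.prod_eq_one fun n _ => ?_
  rw [PowerSeries.constantCoeff_expand, ← PowerSeries.coeff_zero_eq_constantCoeff_apply,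
    PowerSeries.coeff_rescale, pow_zero, one_mul, PowerSeries.coeff_zero_eq_constantCoeff_apply,
    hU]

theorem map_wittProd_eq_one (u : ℕ+ → R) {U : ℕ+ → R⟦X⟧} {I : Ideal R}
    (hU : ∀ n, PowerSeries.map (Ideal.Quotient.mk I) (U n) = 1) (S : Finset ℕ+) :
    PowerSeries.map (Ideal.Quotient.mk I) (wittProd u U S) = 1 := by
  rw [wittProd, map_prod]
  refine Finset.prod_eq_one fun n _ => ?_
  rw [PowerSeries.map_expand, ← PowerSeries.rescale_map, hU, map_one, map_one]

theorem isLogDeriv_wittProd {D : ℕ} {ζ : R} (u : ℕ+ → R) {U : ℕ+ → R⟦X⟧}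
    (hU : ∀ n : ℕ+, (U n).IsLogDeriv (PowerSeries.mk fun k => if 1 ≤ k ∧ k ≤ D / n then
        zetaParam p D ζ (Nat.log p (D / (n * k))) else 0)) (S : Finset ℕ+) :
    (wittProd u U S).IsLogDeriv (PowerSeries.mk fun N => if 1 ≤ N ∧ N ≤ D then
      (∑ n ∈ S.filter (fun n : ℕ+ => (n : ℕ) ∣ N), ((n : ℕ) : R) * u n ^ (N / n)) *
        zetaParam p D ζ (Nat.log p (D / N)) else 0) := by
  refine (PowerSeries.IsLogDeriv.prod _ fun n _ =>
    ((hU n).rescale (u n)).expand n n.ne_zero).of_eq ?_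
  ext N
  have key : ∀ n : ℕ+, PowerSeries.coeff N (((n : ℕ) : R⟦X⟧) * PowerSeries.expand n n.ne_zero
      (PowerSeries.rescale (u n) (PowerSeries.mk fun k => if 1 ≤ k ∧ k ≤ D / n then
        zetaParam p D ζ (Nat.log p (D / (n * k))) else 0))) = if 1 ≤ N ∧ N ≤ D then
          if (n : ℕ) ∣ N then ((n : ℕ) : R) * u n ^ (N / n) * zetaParam p D ζ (Nat.log p (D / N))
          else 0 else 0 := by
    intro n
    rw [← nsmul_eq_mul, map_nsmul, PowerSeries.coeff_expand, nsmul_eq_mul]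
    by_cases h : (n : ℕ) ∣ N
    · obtain ⟨k, rfl⟩ := h
      have hk : (1 ≤ k ∧ k ≤ D / n) ↔ (1 ≤ (n : ℕ) * k ∧ (n : ℕ) * k ≤ D) := by
        rw [Nat.le_div_iff_mul_le n.pos, mul_comm k, Nat.succ_le_iff, Nat.succ_le_iff,
          Nat.mul_pos_iff_of_pos_left n.pos]
      rw [if_pos (dvd_mul_right _ _), Nat.mul_div_cancel_left k n.pos, PowerSeries.coeff_rescale,
        PowerSeries.coeff_mk]
      simp only [hk, dvd_mul_right, if_true]
      split_ifs <;> ring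
    · simp [h]
  rw [PowerSeries.coeff_mk, map_sum, Finset.sum_congr rfl fun n _ => key n]
  split_ifs
  · rw [Finset.sum_mul, Finset.sum_filter]
  · simp

theorem wittProd_mul_eq_one (u : ℕ+ → R) {U V : ℕ+ → R⟦X⟧} (hUV : ∀ n, U n * V n = 1)
    (S : Finset ℕ+) : wittProd u U S * wittProd u V S = 1 := by
  rw [wittProd, wittProd, ← Finset.prod_mul_distrib]
  refine Finset.prod_eq_one fun n _ => ?_
  rw [← map_mul, ← map_mul, hUV, map_one, map_one]

theorem wittProd_mem_polynomialMod {J : Ideal R} (u : ℕ+ → R) (V : ℕ+ → R⟦X⟧) (S : Finset ℕ+)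
    (hu : ∀ n ∈ S, ∀ᶠ k in atTop, u n ^ k ∈ J) :
    wittProd u V S ∈ PowerSeries.polynomialMod J := by
  refine Subring.prod_mem _ fun n hn => ?_
  rw [PowerSeries.mem_polynomialMod]
  obtain ⟨k₀, hk₀⟩ := eventually_atTop.1 (hu n hn)
  refine eventually_atTop.2 ⟨n * k₀, fun i hi => ?_⟩
  rw [PowerSeries.coeff_expand]
  split_ifs with h
  · rw [PowerSeries.coeff_rescale]
    refine J.mul_mem_right _ (hk₀ _ ?_)
    rwa [Nat.le_div_iff_mul_le n.pos, mul_comm]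
  · exact J.zero_mem

variable [hp : Fact p.Prime]

theorem exists_eq_mul_of_one_add_pow_eq_one [IsDomain R] {π : R} (hπ0 : π ≠ 0)
    (hπ1 : (1 + π) ^ p = 1) : ∃ b, (p : R) = π * b := by
  obtain ⟨t, ht⟩ := exists_one_add_pow_prime_eq hp.out π
  obtain ⟨q, hq⟩ : ∃ q, p = q + 2 := ⟨p - 2, by have := hp.out.two_le; omega⟩
  refine ⟨-(π ^ q + p * t), ?_⟩
  apply mul_left_cancel₀ hπ0
  have h1 : π ^ p = π ^ q * π ^ 2 := by rw [← pow_add, ← hq]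
  rw [hπ1, h1] at ht
  linear_combination -ht

theorem isUnit_natCast_of_not_dvd [Algebra ℤ_[p] R] {k : ℕ} (hk : ¬ p ∣ k) :
    IsUnit (k : R) := by
  have : IsUnit ((k : ℕ) : ℤ_[p]) := by
    rw [PadicInt.isUnit_iff, PadicInt.norm_natCast_eq_one_iff]
    exact (Nat.Prime.coprime_iff_not_dvd hp.out).2 hk
  simpa using this.map (algebraMap ℤ_[p] R)

/-- Let `a` be the valuation of `k`; then `a ≤ s`. If `a < s`, a spare factor `p` absorbs `π_0`, and
`π_{d_{nk}}` remains in `c`. If `a = s`, then `d_{nk} = 0`, and `c` is the inverse of the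
prime-to-`p` part of `k`. -/
theorem exists_natCast_mul_eq_pow_mul_zetaParam [IsDomain R] [Algebra ℤ_[p] R] {D s : ℕ} {ζ : R}
    (hπ0 : zetaParam p D ζ 0 ≠ 0) (hζ : ζ ^ p ^ (Nat.log p D + 1) = 1)
    {m : Ideal R} (hζm : ζ - 1 ∈ m) {n k : ℕ} (hn : 0 < n) (hk : 0 < k) (hnk : n * k ≤ D)
    (hs : Nat.log p (D / n) ≤ s) : ∃ c : R,
      k * zetaParam p D ζ 0 * c = p ^ s * zetaParam p D ζ (Nat.log p (D / (n * k))) ∧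
      (¬ p ^ s ∣ k → c ∈ m) ∧ (p ^ s ∣ k → IsUnit c) := by
  have hπ1 : (1 + zetaParam p D ζ 0) ^ p = 1 := by
    rw [zetaParam, add_sub_cancel, ← pow_mul, ← pow_succ, Nat.sub_zero, hζ]
  obtain ⟨b, hb⟩ := exists_eq_mul_of_one_add_pow_eq_one hπ0 hπ1
  set a := k.factorization p with ha
  set k' := ordCompl[p] k with hk'
  have hkk : p ^ a * k' = k := Nat.ordProj_mul_ordCompl_eq_self k p
  have hunit : IsUnit (k' : R) := isUnit_natCast_of_not_dvd (Nat.not_dvd_ordCompl hp.out hk.ne')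
  obtain ⟨w, hw⟩ := hunit.exists_right_inv
  have hkR : (k : R) = p ^ a * k' := by exact_mod_cast congrArg (Nat.cast (R := R)) hkk.symm
  have hkD : k ≤ D / n := (Nat.le_div_iff_mul_le hn).2 (by rwa [mul_comm])
  have has : a ≤ s := by
    refine le_trans ?_ hs
    exact Nat.le_log_of_pow_le hp.out.one_lt
      ((Nat.le_of_dvd hk (Nat.ordProj_dvd k p)).trans hkD)
  have hdvd : p ^ s ∣ k ↔ s ≤ a := hp.out.pow_dvd_iff_le_factorization hk.ne'
  rcases has.lt_or_eq with hlt | heq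
  · obtain ⟨r, hr⟩ := Nat.exists_eq_add_of_lt hlt
    refine ⟨w * b * p ^ r * zetaParam p D ζ (Nat.log p (D / (n * k))), ?_, fun _ => ?_, fun h => ?_⟩
    · rw [hkR, hr, pow_succ, pow_add]
      linear_combination (p ^ a * zetaParam p D ζ 0 * b * p ^ r *
        zetaParam p D ζ (Nat.log p (D / (n * k)))) * hw -
        (p ^ a * p ^ r * zetaParam p D ζ (Nat.log p (D / (n * k)))) * hb
    · exact m.mul_mem_left _ (m.mem_of_dvd (sub_one_dvd_zetaParam p D ζ _) hζm)
    · exact absurd (hdvd.1 h) (by omega)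
  · refine ⟨w, ?_, fun h => absurd (hdvd.2 heq.ge) h, fun _ => IsUnit.of_mul_eq_one _ (by rwa [mul_comm])⟩
    have hlog : Nat.log p (D / (n * k)) = 0 := by
      rw [← hkk, heq, ← Nat.div_div_eq_div_mul, Nat.log_div_pow_mul, Nat.sub_eq_zero_iff_le]
      exact (Nat.log_mono_right (Nat.div_le_self _ _)).trans hs
    rw [hlog, hkR, heq]
    linear_combination (p ^ s * zetaParam p D ζ 0) * hw

/-- The exponent `p ^ s` is just large enough for the logarithm of the power to be `π_0 h` with `h`
integral, and small enough for `h` to survive modulo `m`. -/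
theorem wittProd_notMem_polynomialMod_of_forall_le [IsDomain R] [CharZero R] [Algebra ℤ_[p] R]
    {D : ℕ} {ζ : R} (hπ0 : zetaParam p D ζ 0 ≠ 0) (hζ : ζ ^ p ^ (Nat.log p D + 1) = 1)
    {m J : Ideal R} [m.IsPrime] (hζm : ζ - 1 ∈ m) (hJ : ∀ z, zetaParam p D ζ 0 * z ∈ J → z ∈ m)
    (u : ℕ+ → R) {U : ℕ+ → R⟦X⟧} (hU1 : ∀ n, PowerSeries.constantCoeff (U n) = 1)
    (hU : ∀ n : ℕ+, (U n).IsLogDeriv (PowerSeries.mk fun k => if 1 ≤ k ∧ k ≤ D / n then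
        zetaParam p D ζ (Nat.log p (D / (n * k))) else 0)) {S : Finset ℕ+} {n₀ : ℕ+}
    (hn₀ : n₀ ∈ S) (hn₀D : (n₀ : ℕ) ≤ D) (hmin : ∀ n ∈ S, n₀ ≤ n) (hu : u n₀ ∉ m) :
    wittProd u U S ∉ PowerSeries.polynomialMod J := by
  intro hmem
  set π := zetaParam p D ζ 0 with hπ
  set s := Nat.log p (D / n₀) with hs
  have hπ1 : (1 + π) ^ p = 1 := by
    rw [hπ, zetaParam, add_sub_cancel, ← pow_mul, ← pow_succ, Nat.sub_zero, hζ]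
  have hπm : π ∈ m := m.mem_of_dvd (sub_one_dvd_zetaParam p D ζ _) hζm
  have hpm : (p : R) ∈ m := by
    obtain ⟨b, hb⟩ := exists_eq_mul_of_one_add_pow_eq_one hπ0 hπ1
    rw [hb]
    exact m.mul_mem_right _ hπm
  -- For `M = 1` the exponential is `exp (π X)`.
  obtain ⟨E, hE1, hE, hEm⟩ := exists_isLogDeriv_of_pow_eq_one (p := p) (R := R) (ζ := 1 + π)
    (M := 1) (by simpa using hπ1)
  rw [add_sub_cancel_left] at hEm
  have hE' : E.IsLogDeriv (PowerSeries.C π * PowerSeries.X) := by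
    refine hE.of_eq ?_
    ext N
    rw [PowerSeries.coeff_mk, PowerSeries.coeff_C_mul, PowerSeries.coeff_X]
    by_cases hN : N = 1
    · simp [hN]
    · rw [if_neg (by omega), if_neg hN, mul_zero]
  have hlog : ∀ n ∈ S, Nat.log p (D / n) ≤ s := fun n hn =>
    Nat.log_mono_right (Nat.div_le_div_left (hmin n hn) n₀.pos)
  have hc : ∀ (n : ℕ+) (k : ℕ), ∃ c : R, n ∈ S → 0 < k → n * k ≤ D →
      k * π * c = p ^ s * zetaParam p D ζ (Nat.log p (D / (n * k))) ∧
      (¬ p ^ s ∣ k → c ∈ m) ∧ (p ^ s ∣ k → IsUnit c) := by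
    intro n k
    by_cases h : n ∈ S ∧ 0 < k ∧ n * k ≤ D
    · obtain ⟨c, hc⟩ := exists_natCast_mul_eq_pow_mul_zetaParam hπ0 hζ hζm n.pos h.2.1 h.2.2
        (hlog n h.1)
      exact ⟨c, fun _ _ _ => hc⟩
    · exact ⟨0, fun h1 h2 h3 => absurd ⟨h1, h2, h3⟩ h⟩
  choose c hc using hc
  set h : R⟦X⟧ := PowerSeries.mk fun N => if 1 ≤ N ∧ N ≤ D then
    ∑ n ∈ S.filter (fun n : ℕ+ => (n : ℕ) ∣ N), c n (N / n) * u n ^ (N / n) else 0 with hh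
  have hcoeff : ∀ N, 1 ≤ N → N ≤ D → PowerSeries.coeff N h =
      ∑ n ∈ S.filter (fun n : ℕ+ => (n : ℕ) ∣ N), c n (N / n) * u n ^ (N / n) := by
    intro N h1 h2
    rw [hh, PowerSeries.coeff_mk, if_pos ⟨h1, h2⟩]
  have hh0 : PowerSeries.constantCoeff h = 0 := by
    rw [← PowerSeries.coeff_zero_eq_constantCoeff_apply, hh, PowerSeries.coeff_mk,
      if_neg (by omega)]
  refine PowerSeries.not_eventually_mem_of_isLogDeriv (D := D) hp.out hπ0 hπ1 hπm hpm hJ hE1 hE'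
    hEm (F := wittProd u U S ^ p ^ s) (h := h) ?_ ?_ hh0 ?_ ?_ ?_
    (PowerSeries.mem_polynomialMod.1 (Subring.pow_mem _ hmem _))
  · rw [map_pow, constantCoeff_wittProd u hU1, one_pow]
  · refine ((isLogDeriv_wittProd u hU S).pow _).of_eq ?_
    ext N
    rw [PowerSeries.coeff_X_mul_derivative, PowerSeries.coeff_C_mul, ← nsmul_eq_mul, map_nsmul,
      PowerSeries.coeff_mk, hh, PowerSeries.coeff_mk]
    split_ifs with hN
    · rw [nsmul_eq_mul, Finset.sum_mul, Finset.mul_sum, Finset.mul_sum, Finset.mul_sum]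
      refine Finset.sum_congr rfl fun n hn => ?_
      obtain ⟨hnS, k, rfl⟩ := Finset.mem_filter.1 hn
      rw [Nat.mul_div_cancel_left k n.pos]
      have := (hc n k hnS (Nat.pos_of_mul_pos_left hN.1) hN.2).1
      push_cast
      linear_combination (-((n : ℕ) : R) * u n ^ k) * this
    · simp
  · intro N hN
    rw [hh, PowerSeries.coeff_mk, if_neg (by omega)]
    exact m.zero_mem
  · intro N hN
    rcases Nat.eq_zero_or_pos N with rfl | hN0
    · rw [PowerSeries.coeff_zero_eq_constantCoeff_apply, hh0]
      exact m.zero_mem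
    have hND : N ≤ D := (Nat.le_mul_of_pos_left N hp.out.pos).trans hN
    rw [hcoeff N hN0 hND]
    refine m.sum_mem fun n hn => m.mul_mem_right _ ?_
    obtain ⟨hnS, k, rfl⟩ := Finset.mem_filter.1 hn
    have hk0 : 0 < k := Nat.pos_of_mul_pos_left hN0
    rw [Nat.mul_div_cancel_left k n.pos]
    refine (hc n k hnS hk0 hND).2.1 fun hdvd => ?_
    have h1 : p ^ (s + 1) ≤ D / n := by
      rw [Nat.le_div_iff_mul_le n.pos, pow_succ']
      calc p * p ^ s * n = p * (n * p ^ s) := by ring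
        _ ≤ p * (n * k) := by gcongr; exact Nat.le_of_dvd hk0 hdvd
        _ ≤ D := hN
    have h2 := (Nat.le_log_of_pow_le hp.out.one_lt h1).trans (hlog n hnS)
    omega
  -- In degree `n₀ * p ^ s` only the index `n₀` contributes modulo `m`: any other contributing index
  -- would be a proper divisor of `n₀`, against minimality.
  · have hpos : 0 < p ^ s := pow_pos hp.out.pos s
    have h1 : 1 ≤ (n₀ : ℕ) * p ^ s := Nat.mul_pos n₀.pos hpos
    have h2 : (n₀ : ℕ) * p ^ s ≤ D := by
      rw [mul_comm, ← Nat.le_div_iff_mul_le n₀.pos]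
      exact Nat.pow_log_le_self p (Nat.div_pos hn₀D n₀.pos).ne'
    refine ⟨n₀ * p ^ s, ?_⟩
    have hmem₀ : n₀ ∈ S.filter (fun n : ℕ+ => (n : ℕ) ∣ n₀ * p ^ s) :=
      Finset.mem_filter.2 ⟨hn₀, dvd_mul_right _ _⟩
    rw [hcoeff _ h1 h2, ← Finset.add_sum_erase _ _ hmem₀, Ideal.add_mem_iff_left]
    · rw [Nat.mul_div_cancel_left _ n₀.pos]
      intro h3
      rcases Ideal.IsPrime.mem_or_mem ‹m.IsPrime› h3 with h3 | h3
      · exact Ideal.IsPrime.ne_top ‹m.IsPrime›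
          (m.eq_top_of_isUnit_mem h3 ((hc n₀ _ hn₀ hpos h2).2.2 dvd_rfl))
      · exact hu (Ideal.IsPrime.mem_of_pow_mem ‹m.IsPrime› _ h3)
    · refine m.sum_mem fun n hn => m.mul_mem_right _ ?_
      obtain ⟨hne, hn⟩ := Finset.mem_erase.1 hn
      obtain ⟨hnS, k, hk⟩ := Finset.mem_filter.1 hn
      rw [hk] at h1 h2 ⊢
      rw [Nat.mul_div_cancel_left k n.pos]
      refine (hc n k hnS (Nat.pos_of_mul_pos_left h1) h2).2.1 fun ⟨r, hr⟩ => ?_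
      rw [hr] at hk
      have h3 : (n₀ : ℕ) = n * r := by
        apply Nat.eq_of_mul_eq_mul_right hpos
        rw [hk]
        ring
      have h4 : (n : ℕ) ≤ n₀ := Nat.le_of_dvd n₀.pos ⟨r, h3⟩
      exact hne (le_antisymm h4 (hmin n hnS))

/-- Below the least index `n₀` with `u n₀ ∉ m`, powers of `u n` eventually lie in `J`, so the
inverses of these factors are polynomials modulo `J`. Multiplying by them reduces to indices at
least `n₀`. -/
theorem wittProd_notMem_polynomialMod [IsDomain R] [CharZero R] [Algebra ℤ_[p] R]
    {D : ℕ} {ζ : R} (hπ0 : zetaParam p D ζ 0 ≠ 0) (hζ : ζ ^ p ^ (Nat.log p D + 1) = 1)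
    {m J : Ideal R} [m.IsPrime] (hζm : ζ - 1 ∈ m) (hJ : ∀ z, zetaParam p D ζ 0 * z ∈ J → z ∈ m)
    (hmJ : ∀ z ∈ m, ∀ᶠ k in atTop, z ^ k ∈ J)
    (u : ℕ+ → R) {U : ℕ+ → R⟦X⟧} (hU1 : ∀ n, PowerSeries.constantCoeff (U n) = 1)
    (hU : ∀ n : ℕ+, (U n).IsLogDeriv (PowerSeries.mk fun k => if 1 ≤ k ∧ k ≤ D / n then
        zetaParam p D ζ (Nat.log p (D / (n * k))) else 0)) {S : Finset ℕ+}
    (hSD : ∀ n ∈ S, (n : ℕ) ≤ D) (hu : ∃ n ∈ S, u n ∉ m) :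
    wittProd u U S ∉ PowerSeries.polynomialMod J := by
  classical
  intro hmem
  have hne : (S.filter fun n => u n ∉ m).Nonempty := by
    obtain ⟨n, hn⟩ := hu
    exact ⟨n, Finset.mem_filter.2 hn⟩
  obtain ⟨n₀, hn₀, hmin⟩ := Finset.exists_min_image _ id hne
  rw [Finset.mem_filter] at hn₀
  choose V hV using fun n => PowerSeries.exists_mul_eq_one (hU1 n)
  have h1 : wittProd u V (S.filter fun n => ¬ n₀ ≤ n) ∈ PowerSeries.polynomialMod J := by
    refine wittProd_mem_polynomialMod u V _ fun n hn => hmJ _ ?_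
    rw [Finset.mem_filter] at hn
    by_contra hnm
    exact hn.2 (hmin n (Finset.mem_filter.2 ⟨hn.1, hnm⟩))
  have h2 : wittProd u U S = wittProd u U (S.filter fun n => n₀ ≤ n) *
      wittProd u U (S.filter fun n => ¬ n₀ ≤ n) :=
    (Finset.prod_filter_mul_prod_filter_not _ _ _).symm
  have h3 : wittProd u U (S.filter fun n => n₀ ≤ n) =
      wittProd u U S * wittProd u V (S.filter fun n => ¬ n₀ ≤ n) := by
    rw [h2, mul_assoc, wittProd_mul_eq_one u (fun n => (hV n).1), mul_one]
  refine wittProd_notMem_polynomialMod_of_forall_le hπ0 hζ hζm hJ u hU1 hU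
    (S := S.filter fun n => n₀ ≤ n) (Finset.mem_filter.2 ⟨hn₀.1, le_rfl⟩) (hSD _ hn₀.1)
    (fun n hn => (Finset.mem_filter.1 hn).2) hn₀.2 ?_
  rw [h3]
  exact Subring.mul_mem _ hmem h1

end WittProd

/-! ### Norm ideals of the unit ball -/

section UnitBall

variable {K : Type*} [NormedField K] [IsUltrametricDist K]

theorem mem_unitBall {x : K} : x ∈ unitBall K ↔ ‖x‖ ≤ 1 := by
  rw [Valuation.mem_integer_iff, NormedField.valuation_apply, ← NNReal.coe_le_coe, coe_nnnorm,
    NNReal.coe_one]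

variable (K) in
/-- The ideal of the elements of norm less than `r` of the unit ball. -/
def normIdeal (r : ℝ) (hr : 0 < r) : Ideal (unitBall K) where
  carrier := {x | ‖(x : K)‖ < r}
  add_mem' {x y} hx hy := lt_of_le_of_lt (IsUltrametricDist.norm_add_le_max (x : K) y)
    (max_lt hx hy)
  zero_mem' := by simpa using hr
  smul_mem' c x hx := by
    have hc : ‖(c : K)‖ ≤ 1 := mem_unitBall.1 c.2
    have : ‖(c : K) * x‖ < r := by
      rw [norm_mul]
      exact lt_of_le_of_lt (mul_le_of_le_one_left (norm_nonneg _) hc) hx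
    simpa using this

theorem mem_normIdeal {r : ℝ} {hr : 0 < r} {x : unitBall K} :
    x ∈ normIdeal K r hr ↔ ‖(x : K)‖ < r := Iff.rfl

instance normIdeal_one_isPrime : (normIdeal K 1 one_pos).IsPrime where
  ne_top' := by
    rw [Ideal.ne_top_iff_one, mem_normIdeal]
    simp
  mem_or_mem' {x y} h := by
    rw [mem_normIdeal, Subring.coe_mul, norm_mul] at h
    by_contra! hxy
    rw [mem_normIdeal, mem_normIdeal, not_lt, not_lt] at hxy
    exact absurd h (not_lt.2 (one_le_mul_of_one_le_of_one_le hxy.1 hxy.2))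

theorem eventually_pow_mem_normIdeal {r : ℝ} (hr : 0 < r) {x : unitBall K}
    (hx : x ∈ normIdeal K 1 one_pos) : ∀ᶠ k in atTop, x ^ k ∈ normIdeal K r hr := by
  have h := tendsto_pow_atTop_nhds_zero_of_lt_one (norm_nonneg (x : K)) hx
  filter_upwards [h.eventually_lt_const hr] with k hk
  rwa [mem_normIdeal, Subring.coe_pow, norm_pow]

theorem charZero_unitBall [CharZero K] : CharZero (unitBall K) :=
  (unitBall K).subtype.charZero

variable {p : ℕ} [hp : Fact p.Prime] [NormedAlgebra ℚ_[p] K]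

variable (p K) in
/-- The map from the `p`-adic integers to the unit ball. -/
noncomputable def padicIntToUnitBall : ℤ_[p] →+* unitBall K :=
  ((algebraMap ℚ_[p] K).comp PadicInt.Coe.ringHom).codRestrict (unitBall K) fun z => by
    rw [mem_unitBall, RingHom.comp_apply, norm_algebraMap']
    exact z.2

theorem natCast_mem_normIdeal : (p : unitBall K) ∈ normIdeal K 1 one_pos := by
  have h : ‖((p : ℚ_[p]))‖ < 1 := by
    rw [Padic.norm_p]
    exact inv_lt_one_of_one_lt₀ (by exact_mod_cast hp.out.one_lt)
  rw [← norm_algebraMap' K, map_natCast] at h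
  rw [mem_normIdeal]
  simpa using h

theorem sub_one_mem_normIdeal {ζ : unitBall K} {n : ℕ} (hζ : ζ ^ p ^ n = 1) :
    ζ - 1 ∈ normIdeal K 1 one_pos := by
  obtain ⟨r, hr⟩ := exists_add_pow_prime_pow_eq hp.out (ζ - 1) 1 n
  refine Ideal.IsPrime.mem_of_pow_mem inferInstance (p ^ n) ?_
  rw [sub_add_cancel, hζ, one_pow] at hr
  have : (ζ - 1) ^ p ^ n = -(p * ((ζ - 1) * 1 * r)) := by linear_combination -hr
  rw [this]
  exact neg_mem (Ideal.mul_mem_right _ _ (natCast_mem_normIdeal (p := p)))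

end UnitBall

/-! ### Radius of convergence, the Witt product, and the main theorem -/

theorem FormalMultilinearSeries.radius_ofScalars_eq_one {K : Type*} [NontriviallyNormedField K]
    {a : ℕ → K} (h1 : ∀ i, ‖a i‖ ≤ 1) (h0 : 0 < limsup (fun i => ‖a i‖ₑ) atTop) :
    (FormalMultilinearSeries.ofScalars K a).radius = 1 := by
  apply le_antisymm
  · by_contra! hlt
    have h := (FormalMultilinearSeries.ofScalars K a).summable_norm_mul_pow (r := 1)
      (by simpa using hlt)
    simp only [FormalMultilinearSeries.ofScalars_norm, NNReal.coe_one, one_pow, mul_one] at h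
    have h2 : Tendsto (fun i => ‖a i‖ₑ) atTop (nhds 0) := by
      rw [← enorm_zero (E := K)]
      exact (tendsto_zero_iff_norm_tendsto_zero.2 h.tendsto_atTop_zero).enorm
    rw [h2.limsup_eq] at h0
    exact lt_irrefl _ h0
  · have := (FormalMultilinearSeries.ofScalars K a).le_radius_of_bound 1 (r := 1) fun n => by
      rw [FormalMultilinearSeries.ofScalars_norm, NNReal.coe_one, one_pow, mul_one]
      exact h1 n
    simpa using this

theorem map_eq_piExp {K : Type*} [Field K] [CharZero K] {R : Subring K} {p D : ℕ} {ζ : R}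
    {U : R⟦X⟧} (hU1 : PowerSeries.constantCoeff U = 1)
    (hU : U.IsLogDeriv (PowerSeries.mk fun N => if 1 ≤ N ∧ N ≤ D then
      zetaParam p D ζ (Nat.log p (D / N)) else 0)) :
    PowerSeries.map R.subtype U = piExp p D (ζ : K) := by
  refine (hU.map R.subtype).eq_left ?_ (constantCoeff_piExp p D _)
    ((isLogDeriv_piExp p D (ζ : K)).of_eq ?_)
  · rw [← PowerSeries.coeff_zero_eq_constantCoeff_apply, PowerSeries.coeff_map,
      PowerSeries.coeff_zero_eq_constantCoeff_apply, hU1, map_one]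
  · ext N
    rw [PowerSeries.coeff_map, PowerSeries.coeff_mk, PowerSeries.coeff_mk]
    split_ifs <;> simp [zetaParam, piParam]

theorem ghost_upsilon {K : Type*} [Field K] [CharZero K] (p D : ℕ) (ζ : K) (n : ℕ+) :
    (upsilon p D ζ).ghost n =
      -if (n : ℕ) ≤ D then piParam p D ζ (Nat.log p (D / n)) else 0 := by
  have h := isLogDeriv_piExp p D ζ
  rw [← BigWitt.toSeries_ofSeries (piExp p D ζ) (constantCoeff_piExp p D ζ)] at h
  rw [upsilon, BigWitt.ghost_eq_neg_coeff _ h, PowerSeries.coeff_mk]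
  simp [Nat.succ_le_iff]

theorem BigWitt.ghost_map {A B : Type*} [CommRing A] [CommRing B] (f : A →+* B) (x : BigWitt A)
    (n : ℕ+) : (x.map f).ghost n = f (x.ghost n) := by
  simp [BigWitt.ghost, BigWitt.map]

theorem toSeries_map_mul_upsilon {K : Type*} [Field K] [CharZero K] {R : Subring K} {p D : ℕ}
    {ζ : R} (x : BigWitt R) {u : ℕ+ → R} (hu : ∀ n : ℕ+, (n : ℕ) ≤ D → u n = x.coord n)
    {S : Finset ℕ+} (hS : ∀ n : ℕ+, n ∈ S ↔ (n : ℕ) ≤ D) {F : R⟦X⟧}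
    (hF1 : PowerSeries.constantCoeff F = 1)
    (hF : F.IsLogDeriv (PowerSeries.mk fun N => if 1 ≤ N ∧ N ≤ D then
      (∑ n ∈ S.filter (fun n : ℕ+ => (n : ℕ) ∣ N), ((n : ℕ) : R) * u n ^ (N / n)) *
        zetaParam p D ζ (Nat.log p (D / N)) else 0)) :
    (x.map R.subtype * upsilon p D (ζ : K)).toSeries = PowerSeries.map R.subtype F := by
  refine (BigWitt.isLogDeriv_toSeries _).eq_left (BigWitt.constantCoeff_toSeries _) ?_
    ((hF.map R.subtype).of_eq ?_)
  · rw [← PowerSeries.coeff_zero_eq_constantCoeff_apply, PowerSeries.coeff_map,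
      PowerSeries.coeff_zero_eq_constantCoeff_apply, hF1, map_one]
  · ext N
    rw [PowerSeries.coeff_map, PowerSeries.coeff_mk, BigWitt.negGhostSeries, PowerSeries.coeff_mk]
    rcases Nat.eq_zero_or_pos N with rfl | hN
    · simp
    obtain ⟨n, rfl⟩ : ∃ n : ℕ+, N = n := ⟨⟨N, hN⟩, rfl⟩
    rw [if_pos n.pos, PNat.coe_toPNat', BigWitt.ghost_mul, Pi.mul_apply, ghost_upsilon,
      BigWitt.ghost_map]
    by_cases hn : (n : ℕ) ≤ D
    · rw [if_pos ⟨n.pos, hn⟩, if_pos hn, map_mul, mul_neg, neg_neg]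
      congr 1
      · congr 1
        simp only [BigWitt.ghost]
        have hset : S.filter (fun d : ℕ+ => (d : ℕ) ∣ n) =
            (Finset.Icc 1 n).filter (fun d : ℕ+ => (d : ℕ) ∣ n) := by
          ext d
          simp only [Finset.mem_filter, hS, Finset.mem_Icc]
          refine ⟨fun h => ⟨⟨one_le, ?_⟩, h.2⟩, fun h => ⟨?_, h.2⟩⟩
          · exact Nat.le_of_dvd n.pos h.2
          · exact (Nat.le_of_dvd n.pos h.2).trans hn
        rw [← hset]
        refine Finset.sum_congr rfl fun d hd => ?_
        rw [hu d ((hS d).1 (Finset.mem_filter.1 hd).1)]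
    · rw [if_neg fun h => hn h.2, if_neg hn]
      simp

theorem enorm_lt_enorm_iff {E : Type*} [NormedField E] {x y : E} : ‖x‖ₑ < ‖y‖ₑ ↔ ‖x‖ < ‖y‖ := by
  rw [enorm_eq_nnnorm, enorm_eq_nnnorm, ENNReal.coe_lt_coe, ← NNReal.coe_lt_coe, coe_nnnorm,
    coe_nnnorm]

theorem mainTheorem9 (p : ℕ) [Fact p.Prime] {K : Type*} [NontriviallyNormedField K]
    [NormedAlgebra ℚ_[p] K] [IsUltrametricDist K] [CharZero K]
    (D : ℕ) (ζ : K) (hζ : IsPrimitiveRoot ζ (p ^ (Nat.log p D + 1)))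
    (v : TruncBigWitt D (unitBall K)) (hv : ⨆ i, ‖(v.coord i : K)‖ = 1) :
    (∀ n, (upsilon p D ζ).coord n ∈ unitBall K) ∧
    ∃ f : K⟦X⟧,
      (∀ x : BigWitt (unitBall K), x.trunc D = v →
        (x.map (unitBall K).subtype * upsilon p D ζ).toSeries = f) ∧
      ‖piParam p D ζ 0‖ₑ ≤ limsup (fun i => ‖PowerSeries.coeff i f‖ₑ) atTop ∧
      limsup (fun i => ‖PowerSeries.coeff i f‖ₑ) atTop < 1 ∧
      (FormalMultilinearSeries.ofScalars K fun i => PowerSeries.coeff i f).radius = 1 := by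
  have hp : p.Prime := Fact.out
  let _ : Algebra ℤ_[p] (unitBall K) := (padicIntToUnitBall K p).toAlgebra
  have : CharZero (unitBall K) := charZero_unitBall
  have hζ1 : ‖ζ‖ = 1 := by
    rw [← pow_eq_one_iff_of_nonneg (norm_nonneg ζ) (pow_pos hp.pos (Nat.log p D + 1)).ne',
      ← norm_pow, hζ.pow_eq_one, norm_one]
  lift ζ to unitBall K using mem_unitBall.2 hζ1.le
  have hζpow : ζ ^ p ^ (Nat.log p D + 1) = 1 := by
    apply Subtype.coe_injective
    simpa using hζ.pow_eq_one
  have hζm := sub_one_mem_normIdeal hζpow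
  have hπ0 : ((zetaParam p D ζ 0 : unitBall K) : K) ≠ 0 := by
    have := hζ.pow_ne_one_of_pos_of_lt (pow_pos hp.pos (Nat.log p D)).ne'
      (Nat.pow_lt_pow_right hp.one_lt (Nat.lt_succ_self _))
    simpa [zetaParam, sub_eq_zero] using this
  have hπ : ‖((zetaParam p D ζ 0 : unitBall K) : K)‖ₑ = ‖piParam p D (ζ : K) 0‖ₑ := by simp [zetaParam, piParam]
  choose U hU1 hU hUm using exists_isLogDeriv_zetaParam (p := p) hζpow
  refine ⟨fun n => ?_, ?_⟩
  · obtain ⟨a, ha⟩ := BigWitt.coord_mem_range_of_toSeries_eq_map (unitBall K).subtype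
      (upsilon p D (ζ : K)) (U 1) (hU1 1) (by
        rw [upsilon, BigWitt.toSeries_ofSeries, map_eq_piExp (p := p) (D := D) (hU1 1)]
        refine (hU 1).of_eq ?_
        simp) n
    rw [← ha]
    exact a.2
  -- The real supremum of an empty family is `0`, so `hv` forces `0 < D`.
  have hD : Nonempty (Fin D) := by
    by_contra h
    rw [not_nonempty_iff] at h
    rw [Real.iSup_of_isEmpty] at hv
    exact zero_ne_one hv
  obtain ⟨i₀, hi₀⟩ := exists_eq_ciSup_of_finite (f := fun i => ‖(v.coord i : K)‖)
  rw [hv] at hi₀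
  have hD0 : 0 < D := i₀.pos
  set u : ℕ+ → unitBall K := fun n =>
    if h : n.natPred < D then v.coord ⟨n.natPred, h⟩ else 0 with hu
  set S : Finset ℕ+ := Finset.Icc 1 (D.toPNat hD0) with hS
  have hSD : ∀ n : ℕ+, n ∈ S ↔ (n : ℕ) ≤ D := fun n => by
    rw [hS, Finset.mem_Icc]
    exact ⟨fun h => h.2, fun h => ⟨one_le, h⟩⟩
  set F := wittProd u U S
  have hF1 := constantCoeff_wittProd u hU1 S
  have hFcoeff : ∀ i, 0 < i → ‖((PowerSeries.coeff i F : unitBall K) : K)‖ ≤ ‖(ζ : K) - 1‖ := by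
    intro i hi
    have h := congrArg (PowerSeries.coeff i) (map_wittProd_eq_one u hUm S)
    rw [PowerSeries.coeff_map, PowerSeries.coeff_one, if_neg hi.ne', Ideal.Quotient.eq_zero_iff_mem,
      Ideal.mem_span_singleton] at h
    obtain ⟨c, hc⟩ := h
    rw [hc, Subring.coe_mul, norm_mul]
    exact mul_le_of_le_one_right (norm_nonneg _) (mem_unitBall.1 c.2)
  have hζlt : ‖(ζ : K) - 1‖ < 1 := by simpa [mem_normIdeal] using hζm
  have hmap : ∀ i, PowerSeries.coeff i (PowerSeries.map (unitBall K).subtype F) =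
      ((PowerSeries.coeff i F : unitBall K) : K) := fun i => PowerSeries.coeff_map _ _ _
  have hlower : ‖piParam p D (ζ : K) 0‖ₑ ≤
      limsup (fun i => ‖PowerSeries.coeff i (PowerSeries.map (unitBall K).subtype F)‖ₑ) atTop := by
    by_contra! hlt
    have hev := eventually_lt_of_limsup_lt hlt
    -- `m` is the open unit ball and `J` the open ball of radius `|π_0|`, so `π_0 z ∈ J` forces `z ∈
    -- m`.
    refine wittProd_notMem_polynomialMod (m := normIdeal K 1 one_pos)
      (J := normIdeal K _ (norm_pos_iff.2 hπ0)) (fun h => hπ0 (by rw [h]; rfl)) hζpow hζm ?_ ?_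
      u hU1 hU (S := S) (fun n hn => (hSD n).1 hn) ?_ (PowerSeries.mem_polynomialMod.2 ?_)
    · intro z hz
      rw [mem_normIdeal, Subring.coe_mul, norm_mul] at hz
      rw [mem_normIdeal]
      exact (mul_lt_iff_lt_one_right (norm_pos_iff.2 hπ0)).1 hz
    · exact fun z hz => eventually_pow_mem_normIdeal _ hz
    · refine ⟨Nat.succPNat i₀, (hSD _).2 i₀.2, ?_⟩
      rw [mem_normIdeal, hu]
      simp [hi₀]
    · filter_upwards [hev] with i hi
      rw [hmap, ← hπ, enorm_lt_enorm_iff] at hi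
      exact hi
  refine ⟨PowerSeries.map (unitBall K).subtype F, fun x hx => ?_, hlower, ?_, ?_⟩
  · refine toSeries_map_mul_upsilon x (u := u) (fun n hn => ?_) hSD hF1 (isLogDeriv_wittProd u hU S)
    have hlt : n.natPred < D := by
      have := PNat.natPred_add_one n
      omega
    simp [hu, hlt, ← hx, BigWitt.trunc]
  · refine lt_of_le_of_lt (limsup_le_of_le (a := ‖(ζ : K) - 1‖ₑ) (by isBoundedDefault) ?_) ?_
    · filter_upwards [eventually_gt_atTop 0] with i hi
      rw [hmap, enorm_le_iff_norm_le]
      exact hFcoeff i hi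
    · rw [← enorm_one (G := K), enorm_lt_enorm_iff, norm_one]
      exact hζlt
  · refine FormalMultilinearSeries.radius_ofScalars_eq_one (fun i => ?_) (lt_of_lt_of_le ?_ hlower)
    · rw [hmap]
      exact mem_unitBall.1 (PowerSeries.coeff i F).2
    · rw [← hπ]
      simpa using hπ0
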